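/- **Conventions.** A *quantum system* is the algebra $L(\mathcal H)$ of all operators on a nonzero finite-dimensional complex Hilbert space; juxtaposition of systems denotes their tensor product, and the empty tensor product is $\mathbb C$. A *unitary channel* is a $*$-isomorphism between quantum systems. Let $\mathtt A,\mathtt B$ be finite sets and let $A_{\mathtt a}$ ($\mathtt a\in\mathtt A$), $B_{\mathtt b}$ ($\mathtt b\in\mathtt B$) be quantum systems. For $\alpha\subseteq\mathtt A$ write $A_\alpha=\bigotimes_{\mathtt a\in\alpha}A_{\mathtt a}$, also regarded as the subalgebra $A_\alpha\otimes 1$ of $A_{\mathtt A}$, and similarly $B_\beta$ for $\beta\subseteq\mathtt B$; likewise any tensor factor of a composite system is identified with the corresponding subalgebra. For a unitary channel $\mathcal U:A_{\mathtt A}\to B_{\mathtt B}$, with Hilbert–Schmidt adjoint $\mathcal U^\dagger=\mathcal U^{-1}$, the *causal structure* $G_{\mathcal U}\subseteq\mathtt A\times\mathtt B$ is the relation with $(\mathtt a,\mathtt b)\in G_{\mathcal U}$ iff $\mathcal U^\dagger(B_{\mathtt b})\not\subseteq (A_{\mathtt a})'$, where $'$ denotes the commutant in $A_{\mathtt A}$.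 A relation $G\subseteq\mathtt A\times\mathtt B$ satisfies the *$C_3$ exclusion property* if there are no $\mathtt a_1,\mathtt a_2,\mathtt a_3\in\mathtt A$ and $\mathtt b_1,\mathtt b_2,\mathtt b_3\in\mathtt B$ such that, among the nine pairs $(\mathtt a_i,\mathtt b_j)$, exactly $(\mathtt a_1,\mathtt b_3)$ and $(\mathtt a_3,\mathtt b_1)$ are not in $G$. For $\alpha\subseteq\mathtt A$, $\beta\subseteq\mathtt B$ let $\mathfrak c(\alpha)=\{\mathtt b\mid \forall \mathtt a\in\alpha:(\mathtt a,\mathtt b)\in G\}$ and $\mathfrak p(\beta)=\{\mathtt a\mid\forall \mathtt b\in\beta:(\mathtt a,\mathtt b)\in G\}$. The *canonical circuit shape* $\mathcal L(G)$ is the set of pairs $v=\langle\alpha_v,\beta_v\rangle$ with $\alpha_v=\mathfrak p(\beta_v)$ and $\beta_v=\mathfrak c(\alpha_v)$, ordered by $v\le w\iff\alpha_v\subseteq\alpha_w$, together with the maps $\lambda:\mathtt A\to\mathcal L(G)$, $\lambda(\mathtt a)=\langle\mathfrak{pc}\{\mathtt a\},\mathfrak c\{\mathtt a\}\rangle$,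 and $\mu:\mathtt B\to\mathcal L(G)$, $\mu(\mathtt b)=\langle\mathfrak p\{\mathtt b\},\mathfrak{cp}\{\mathtt b\}\rangle$. Write $v\lessdot w$ if $w$ covers $v$, and ${\downarrow}v=\{u\mid u\le v\}$. A *unitary circuit of shape $\mathcal L(G)$* consists of quantum systems $Z_v^w$ for all $v\lessdot w$ in $\mathcal L(G)$ and unitary channels $$\mathcal V_v:\ A_{\lambda^{-1}(v)}\otimes\bigotimes_{u\lessdot v}Z_u^v\ \xrightarrow{\ \sim\ }\ \bigotimes_{w\gtrdot v}Z_v^w\otimes B_{\mu^{-1}(v)}\qquad(v\in\mathcal L(G)).$$ For a downward closed $T\subseteq\mathcal L(G)$, let $\mathcal V_T$ be the composition of the $\mathcal V_v$, $v\in T$, along the systems $Z_v^w$ with $v,w\in T$, $v\lessdot w$, tensored with the identity on the $A_{\mathtt a}$ with $\lambda(\mathtt a)\notin T$. Thus $\mathcal V_T$ maps $A_{\mathtt A}$ to the tensor product of all $A_{\mathtt a}$ with $\lambda(\mathtt a)\notin T$, all $Z_v^w$ with $v\in T$, $w\notin T$, and all $B_{\mathtt b}$ with $\mu(\mathtt b)\in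 T$; in particular $\mathcal V_{\mathcal L(G)}:A_{\mathtt A}\to B_{\mathtt B}$. **Theorem.** Let $G\subseteq\mathtt A\times\mathtt B$ satisfy the $C_3$ exclusion property and let $\mathcal U:A_{\mathtt A}\to B_{\mathtt B}$ be a unitary channel with $G_{\mathcal U}\subseteq G$. Then there exist quantum systems $Z_v^w$ for all $v\lessdot w$ in $\mathcal L(G)$ and unitary channels $\mathcal V_v$ for all $v\in\mathcal L(G)$ as above such that for all $v\in\mathcal L(G)$ $$B_{\mathtt b}=\mathcal V_{{\downarrow}v}\,\mathcal U^\dagger(B_{\mathtt b})\quad\text{for all }\mathtt b\in\mu^{-1}(v),\qquad\qquad Z_v^w\subseteq\mathcal V_{{\downarrow}v}\,\mathcal U^\dagger(B_{\beta_w})\quad\text{for all }w\gtrdot v,$$ and such that $\mathcal V_{\mathcal L(G)}$ equals $\mathcal U$ up to local unitary channels on the outputs: there are unitary channels $\mathcal W_{\mathtt b}:B_{\mathtt b}\to B_{\mathtt b}$ with $\mathcal U=\big(\bigotimes_{\mathtt b\in\mathtt B}\mathcal W_{\mathtt b}\big)\circ\mathcal V_{\mathcal L(G)}$. Moreover, $\mathcal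 U$ has a unitary circuit decomposition of shape $\mathcal L(G)$: there is a unitary circuit of shape $\mathcal L(G)$ with inputs $A_{\mathtt a}$ and outputs $B_{\mathtt b}$ whose composition $\mathcal V_{\mathcal L(G)}$ is equal to $\mathcal U$. -/

import Mathlib

universe u v w t

namespace CausalCircuits

/-! ### Quantum systems

A finite-dimensional Hilbert space with an orthonormal basis labelled by `ι` is `ℂ^ι`, and its
algebra of operators is the full matrix algebra `Matrix ι ι ℂ`. A quantum system is such an algebra
with `ι` finite and nonempty. The tensor product of a family of systems with basis labels `X i` is
the system whose basis labels are the families `x i : X i`. -/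

/-- The algebra of operators on `ℂ^ι`. -/
abbrev Op (ι : Type t) : Type t := Matrix ι ι ℂ

/-- The basis labels of the tensor product `⨂ i, ℂ^(X i)`. -/
def Config {I : Type u} (X : I → Type t) : Type (max u t) := ∀ i, X i

instance {I : Type u} (X : I → Type t) [Finite I] [∀ i, Finite (X i)] : Finite (Config X) :=
  inferInstanceAs (Finite (∀ i, X i))

noncomputable instance {I : Type u} (X : I → Type t) [Finite I] [∀ i, Finite (X i)] :
    Fintype (Config X) :=
  Fintype.ofFinite _

instance {I : Type u} (X : I → Type t) [∀ i, Nonempty (X i)] : Nonempty (Config X) :=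
  inferInstanceAs (Nonempty (∀ i, X i))

/-- The subalgebra `L(⨂_{i ∈ s} ℂ^(X i)) ⊗ 1` of `L(⨂_i ℂ^(X i))`: the operators `N ⊗ 1` that act
by an operator `N` on the factors in `s` and as the identity on all other factors. -/
def localOps {I : Type u} (X : I → Type t) (s : Set I) : Set (Op (Config X)) :=
  {M | ∃ N : Op (Config fun i : s => X i), ∀ x y : Config X,
    ((∀ i, i ∉ s → x i = y i) → M x y = N (fun i => x i) (fun i => y i)) ∧
    ((¬ ∀ i, i ∉ s → x i = y i) → M x y = 0)}

open Classical in
/-- The matrix coefficient `⟨o| E(|i⟩⟨i'|) |o'⟩` of a map between operator algebras. -/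
noncomputable def coeff {m n : Type*} (E : Op m → Op n) (o o' : n) (i i' : m) : ℂ :=
  E (Matrix.single i i' 1) o o'

/-- The linear map between operator algebras that has the given matrix coefficients. -/
noncomputable def ofCoeff {m n : Type*} [Fintype m] (K : n → n → m → m → ℂ) : Op m →ₗ[ℂ] Op n where
  toFun M := Matrix.of fun o o' => ∑ i, ∑ i', K o o' i i' * M i i'
  map_add' M N := by
    ext o o'
    simp [mul_add, Finset.sum_add_distrib]
  map_smul' c M := by
    ext o o'
    simp [Finset.mul_sum, mul_left_comm]

/-- The tensor product `⨂_i E_i` of a finite family of maps between operator algebras. -/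
noncomputable def tensorMap {I : Type u} [Finite I] {X Y : I → Type t} [∀ i, Finite (X i)]
    (E : ∀ i, Op (X i) → Op (Y i)) : Op (Config X) →ₗ[ℂ] Op (Config Y) :=
  ofCoeff fun o o' i i' => ∏ᶠ k, coeff (E k) (o k) (o' k) (i k) (i' k)

/-! ### Causal structure -/

section Causal

variable {A : Type u} {B : Type v} [Finite A] [Finite B] {X : A → Type t} {Y : B → Type t}
  [∀ a, Finite (X a)] [∀ b, Finite (Y b)]

/-- The input systems in `s` influence the output systems in `r` through the unitary channel `U`:
it is not the case that `U†(B_r) ⊆ (A_s)'`. The adjoint `U†` of the star-isomorphism `U` with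
respect to the Hilbert-Schmidt inner products is its inverse. -/
def Influences (U : Op (Config X) ≃⋆ₐ[ℂ] Op (Config Y)) (s : Set A) (r : Set B) : Prop :=
  ¬ U.symm '' localOps Y r ⊆ Set.centralizer (localOps X s)

/-- The causal structure `G_U` of a unitary channel `U`. -/
def causalStructure (U : Op (Config X) ≃⋆ₐ[ℂ] Op (Config Y)) (a : A) (b : B) : Prop :=
  Influences U {a} {b}

end Causal

/-- The relation `G` restricts nowhere to the relation `C₃`, in which `a₁` is related to `b₁, b₂`
only, `a₂` to `b₁, b₂, b₃`, and `a₃` to `b₂, b₃` only. -/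
def C3Exclusion {A : Type u} {B : Type v} (G : A → B → Prop) : Prop :=
  ∀ (a₁ a₂ a₃ : A) (b₁ b₂ b₃ : B),
    ¬ ((G a₁ b₁ ∧ G a₁ b₂ ∧ ¬ G a₁ b₃) ∧
       (G a₂ b₁ ∧ G a₂ b₂ ∧ G a₂ b₃) ∧
       (¬ G a₃ b₁ ∧ G a₃ b₂ ∧ G a₃ b₃))

/-! ### Circuit shapes -/

/-- A circuit shape with inputs `A` and outputs `B`: a finite poset of boxes with maps that attach
the inputs and the outputs to boxes. -/
structure CircuitShape (A : Type u) (B : Type v) where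
  Box : Type w
  [order : PartialOrder Box]
  [finite : Finite Box]
  inp : A → Box
  out : B → Box

attribute [instance] CircuitShape.order CircuitShape.finite

instance {A : Type u} {B : Type v} [Finite A] (G : A → B → Prop) : Finite (Concept A B G) :=
  Finite.of_injective _ Concept.extent_injective

/-- The canonical circuit shape of `G`: the concept lattice of `G`, with the input `a` attached to
the concept `⟨pc{a}, c{a}⟩` and the output `b` attached to the concept `⟨p{b}, cp{b}⟩`. -/
def canonicalShape {A : Type u} {B : Type v} [Finite A] (G : A → B → Prop) :
    CircuitShape.{u, v, max u v} A B where
  Box := Concept A B G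
  inp a := Concept.ofObject G a
  out b := Concept.ofAttribute G b

namespace CircuitShape

variable {A : Type u} {B : Type v} (S : CircuitShape.{u, v, w} A B)

/-- The wires of the circuit diagram: one for each input, each cover `p ⋖ q`, and each output. -/
inductive Wire : Type (max u v w)
  | input (a : A) : Wire
  | inner (p q : S.Box) (h : p ⋖ q) : Wire
  | output (b : B) : Wire

variable {S}

/-- The box that a wire comes out of, if any. -/
def Wire.source : S.Wire → Option S.Box
  | .input _ => none
  | .inner p _ _ => some p
  | .output b => some (S.out b)

/-- The box that a wire goes into, if any. -/
def Wire.target : S.Wire → Option S.Box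
  | .input a => some (S.inp a)
  | .inner _ q _ => some q
  | .output _ => none

instance [Finite A] [Finite B] : Finite S.Wire := by
  let f : S.Wire → A ⊕ (S.Box × S.Box) ⊕ B := fun x =>
    match x with
    | .input a => .inl a
    | .inner p q _ => .inr (.inl (p, q))
    | .output b => .inr (.inr b)
  refine Finite.of_injective f ?_
  intro x y hxy
  cases x <;> cases y <;> simp_all [f]

/-- The wires that are overall inputs or come out of a box in `T`. -/
def Wire.Past (T : LowerSet S.Box) (x : S.Wire) : Prop :=
  ∀ p, x.source = some p → p ∈ T

/-- The wires that are present once exactly the boxes in `T` have been applied: the overall inputs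
and the wires that come out of a box in `T`, except for those that go into a box in `T`. -/
def Wire.Live (T : LowerSet S.Box) (x : S.Wire) : Prop :=
  x.Past T ∧ ∀ p, x.target = some p → p ∉ T

theorem Wire.past_of_source {T : LowerSet S.Box} {x : S.Wire} {p : S.Box} (hp : p ∈ T)
    (hx : x.source = some p) : x.Past T := by
  intro q hq
  rw [hx] at hq
  exact Option.some.inj hq ▸ hp

theorem Wire.past_of_target {T : LowerSet S.Box} {x : S.Wire} {p : S.Box} (hp : p ∈ T)
    (hx : x.target = some p) : x.Past T := by
  intro q hq
  cases x with
  | input a => simp [Wire.source] at hq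
  | inner r s h =>
    simp only [Wire.source, Wire.target, Option.some.injEq] at hq hx
    subst hq hx
    exact T.lower h.le hp
  | output b => simp [Wire.target] at hx

theorem Wire.past_input (T : LowerSet S.Box) (a : A) : (Wire.input a : S.Wire).Past T := by
  intro q hq
  simp [Wire.source] at hq

theorem Wire.live_output {b : B} {v : S.Box} (h : S.out b = v) :
    (Wire.output b : S.Wire).Live (LowerSet.Iic v) := by
  refine ⟨fun p hp => ?_, fun p hp => ?_⟩
  · simp only [Wire.source, Option.some.injEq] at hp
    exact LowerSet.mem_Iic_iff.2 (hp ▸ h.le)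
  · simp [Wire.target] at hp

theorem Wire.live_inner {v w : S.Box} (h : v ⋖ w) :
    (Wire.inner v w h : S.Wire).Live (LowerSet.Iic v) := by
  refine ⟨fun p hp => ?_, fun p hp hv => ?_⟩
  · simp only [Wire.source, Option.some.injEq] at hp
    exact LowerSet.mem_Iic_iff.2 hp.ge
  · simp only [Wire.target, Option.some.injEq] at hp
    subst hp
    exact h.lt.not_ge (LowerSet.mem_Iic_iff.1 hv)

end CircuitShape

open CircuitShape

/-! ### Unitary circuits -/

/-- The basis labels of the system carried by each wire. -/
def wireSystem {A : Type u} {B : Type v} {S : CircuitShape.{u, v, w} A B} (X : A → Type t)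
    (Y : B → Type t) (Z : ∀ p q : S.Box, p ⋖ q → Type t) : S.Wire → Type t
  | .input a => X a
  | .inner p q h => Z p q h
  | .output b => Y b

instance {A : Type u} {B : Type v} {S : CircuitShape.{u, v, w} A B} (X : A → Type t)
    (Y : B → Type t) (Z : ∀ p q : S.Box, p ⋖ q → Type t) [∀ a, Finite (X a)] [∀ b, Finite (Y b)]
    [∀ p q h, Finite (Z p q h)] (x : S.Wire) : Finite (wireSystem X Y Z x) := by
  cases x <;> dsimp only [wireSystem] <;> infer_instance

/-- A circuit of shape `S` with inputs `X` and outputs `Y` all of whose gates are unitary channels,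
that is, star-isomorphisms. It consists of a quantum system `Z p q` for each cover `p ⋖ q` and of a
unitary channel for each box `p`, from the tensor product of all wires that go into `p` to the
tensor product of all wires that come out of `p`. -/
structure UnitaryCircuit {A : Type u} {B : Type v} [Finite A] [Finite B]
    (S : CircuitShape.{u, v, w} A B) (X : A → Type t) (Y : B → Type t)
    [∀ a, Finite (X a)] [∀ b, Finite (Y b)] where
  Z : ∀ p q : S.Box, p ⋖ q → Type t
  [finiteZ : ∀ p q h, Finite (Z p q h)]
  [nonemptyZ : ∀ p q h, Nonempty (Z p q h)]
  gate : ∀ p : S.Box,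
    Op (Config fun x : {x : S.Wire // x.target = some p} => wireSystem X Y Z x.1) ≃⋆ₐ[ℂ]
      Op (Config fun x : {x : S.Wire // x.source = some p} => wireSystem X Y Z x.1)

attribute [instance] UnitaryCircuit.finiteZ UnitaryCircuit.nonemptyZ

namespace UnitaryCircuit

variable {A : Type u} {B : Type v} [Finite A] [Finite B] {S : CircuitShape.{u, v, w} A B}
  {X : A → Type t} {Y : B → Type t} [∀ a, Finite (X a)] [∀ b, Finite (Y b)]
  (C : UnitaryCircuit S X Y)

/-- The system carried by a wire of the circuit. -/
abbrev sys (x : S.Wire) : Type t := wireSystem X Y C.Z x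

/-- The systems that are present once exactly the boxes in `T` have been applied. -/
abbrev liveSys (T : LowerSet S.Box) (x : {x : S.Wire // x.Live T}) : Type t := C.sys x.1

/-- Assignments of basis labels to the inputs and to the wires that come out of a box in `T`. -/
abbrev Hist (T : LowerSet S.Box) : Type (max u v w t) :=
  Config fun x : {x : S.Wire // x.Past T} => C.sys x.1

variable {C} {T : LowerSet S.Box}

/-- The labels of the overall inputs. -/
def Hist.inputs (z : C.Hist T) : Config X := fun a => z ⟨.input a, Wire.past_input T a⟩

/-- The labels of the wires that are present once the boxes in `T` have been applied. -/
def Hist.live (z : C.Hist T) : Config (C.liveSys T) := fun x => z ⟨x.1, x.2.1⟩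

/-- The labels of the wires that go into the box `p`. -/
def Hist.into (z : C.Hist T) {p : S.Box} (hp : p ∈ T) :
    Config fun x : {x : S.Wire // x.target = some p} => C.sys x.1 :=
  fun x => z ⟨x.1, Wire.past_of_target hp x.2⟩

/-- The labels of the wires that come out of the box `p`. -/
def Hist.outOf (z : C.Hist T) {p : S.Box} (hp : p ∈ T) :
    Config fun x : {x : S.Wire // x.source = some p} => C.sys x.1 :=
  fun x => z ⟨x.1, Wire.past_of_source hp x.2⟩

variable (C) (T)

open Classical in
/-- The channel composed of the gates in the lower set `T`, tensored with the identity on the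
inputs that do not enter a gate in `T`; it maps the operators on all inputs to the operators on the
systems that are present once the boxes in `T` have been applied. The gates are composed by
contracting their coefficients along the wires between them: each wire `x` contributes a pair of
labels `z x`, `z' x`, shared by the gate that it comes out of and the gate that it goes into, and
the labels of the wires that are not overall inputs or outputs of the composite are summed over.
An input that enters no gate in `T` has the same labels on both sides. -/
noncomputable def compose : Op (Config X) →ₗ[ℂ] Op (Config (C.liveSys T)) :=
  ofCoeff fun o o' i i' =>
    ∑ z : C.Hist T, ∑ z' : C.Hist T,
      if z.inputs = i ∧ z'.inputs = i' ∧ z.live = o ∧ z'.live = o' then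
        ∏ᶠ p : {p : S.Box // p ∈ T},
          coeff (C.gate p.1) (z.outOf p.2) (z'.outOf p.2) (z.into p.2) (z'.into p.2)
      else 0

/-- Labels of the outputs, as labels of the wires that are present once all boxes have been
applied. -/
def finalLabels (y : Config Y) : Config (C.liveSys ⊤)
  | ⟨.input _, h⟩ => (h.2 _ rfl (LowerSet.mem_top)).elim
  | ⟨.inner _ _ _, h⟩ => (h.2 _ rfl (LowerSet.mem_top)).elim
  | ⟨.output b, _⟩ => y b

/-- The channel from all inputs to all outputs composed of all gates of the circuit. -/
noncomputable def total : Op (Config X) →ₗ[ℂ] Op (Config Y) where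
  toFun M := (C.compose ⊤ M).submatrix C.finalLabels C.finalLabels
  map_add' M N := by
    ext y y'
    simp
  map_smul' c M := by
    ext y y'
    simp

end UnitaryCircuit

end CausalCircuits

open CausalCircuits CausalCircuits.CircuitShape

/-!
Pull everything back to the algebra `M` of operators on all inputs: the factor of the input `a` is
the algebra `A_a`, and the factor of the output `b` is `U†(B_b)`, so that `M` carries two tensor
factorisations, whose factors commute unless they are related by `G`. For sets `α` of inputs and `β`
of outputs let `N(α, β)` (`localAlgebra`) be the intersection of `A_α` with `U†(B_β)`, that is, the
commutant of the factors outside `α` and outside `β`. A wire `p ⋖ q` of the canonical circuit is made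
to carry `N(α_p, β_q)` (`wireAlgebra`), an input `a` carries `A_a`, and an output `b` carries
`U†(B_b)`. The algebra of a box `p` is `N(α_p, β_p)` (`boxAlgebra`).

The `C₃` exclusion property says that two concepts that share an object and an attribute are
comparable (`C3Exclusion.le_or_le`). It follows that two wires that are live at the same time have
disjoint causes or disjoint effects, whence their algebras commute (`commute_wireAlgebra`), and that
the extent of a box `p` is partitioned by the wires into `p` in such a way that an output outside
`β_p` is related to at most one part. Under the latter condition, slicing with matrix units shows
that `N(α_p, β_p)` is generated by the algebras of the parts
(`IsFactorization.localAlgebra_iUnion_le`). So the algebra of a box is generated by the commuting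
algebras of the wires into it, and dually by those of the wires out of it.

It remains to see that the wires carry full matrix algebras. A tensor product of matrix algebras has
trivial centre, and so has each of its tensor factors; and a star-closed algebra of matrices with
trivial centre is a full matrix algebra (`exists_matrixUnits`). Induction from the bottom of the
concept lattice upwards gives the claim (`exists_matrixUnits_inner`).

The gate of a box is now the identity of its algebra, read in the matrix units of the wires into the
box on one side and of the wires out of the box on the other. Hence the composite of the gates in a
lower set `T` is the identity of `M`, read in the matrix units of the wires that are live after `T`
(`UnitaryCircuit.WireUnits.sum_compose_smul_live`). As the output `b` carries `U†(B_b)`, with its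
matrix units taken over from `B_b` along `U†`, the composite of all gates is `U` itself. The local
unitary channels on the outputs can therefore be chosen to be the identity, and the same circuit
serves for both parts of the theorem.
-/

namespace CausalCircuits

/-! ### Products of commuting families -/

section OrderedProd

variable {M : Type*}

/-- The product of a finite family in an arbitrarily chosen order. The choice is irrelevant for
families of pairwise commuting elements. -/
noncomputable def orderedProd [Monoid M] {I : Type*} [Finite I] (f : I → M) : M :=
  (List.ofFn fun k => f ((Finite.equivFin I).symm k)).prod

/-- The finite index type `I` as a list, in the order used by `orderedProd`. -/
noncomputable def indexList (I : Type*) [Finite I] : List I :=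
  List.ofFn (Finite.equivFin I).symm

theorem nodup_indexList (I : Type*) [Finite I] : (indexList I).Nodup :=
  List.nodup_ofFn.2 (Finite.equivFin I).symm.injective

theorem mem_indexList {I : Type*} [Finite I] (i : I) : i ∈ indexList I :=
  (List.mem_ofFn' _ _).2 ((Finite.equivFin I).symm.surjective i)

variable [Monoid M] {I J K : Type*} [Finite I] [Finite J] [Finite K]

theorem orderedProd_eq_list (f : I → M) : orderedProd f = ((indexList I).map f).prod := by
  rw [orderedProd, indexList, List.map_ofFn]
  rfl

theorem orderedProd_eq_of_perm {f : I → M} (hf : Pairwise fun i j => Commute (f i) (f j))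
    {l : List I} (hl : l.Nodup) (hmem : ∀ i, i ∈ l) : orderedProd f = (l.map f).prod := by
  rw [orderedProd_eq_list]
  refine List.Perm.prod_eq' (((List.perm_ext_iff_of_nodup (nodup_indexList I) hl).2
    fun i => iff_of_true (mem_indexList i) (hmem i)).map f) ?_
  rw [List.pairwise_map]
  exact (nodup_indexList I).imp fun h => hf h

/-- Splitting a product of commuting elements along a partition of the index type. -/
theorem orderedProd_eq_mul {f : I → M} (hf : Pairwise fun i j => Commute (f i) (f j))
    {g : J → I} {h : K → I} (hg : g.Injective) (hh : h.Injective) (hgh : ∀ j k, g j ≠ h k)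
    (hcover : ∀ i, (∃ j, g j = i) ∨ ∃ k, h k = i) :
    orderedProd f = orderedProd (f ∘ g) * orderedProd (f ∘ h) := by
  rw [orderedProd_eq_of_perm hf (l := (indexList J).map g ++ (indexList K).map h)]
  · simp [orderedProd_eq_list]
  · refine List.Nodup.append ((nodup_indexList J).map hg) ((nodup_indexList K).map hh) ?_
    intro i hi hi'
    obtain ⟨j, -, rfl⟩ := List.mem_map.1 hi
    obtain ⟨k, -, hk⟩ := List.mem_map.1 hi'
    exact hgh j k hk.symm
  · intro i
    rcases hcover i with ⟨j, rfl⟩ | ⟨k, rfl⟩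
    · exact List.mem_append_left _ (List.mem_map_of_mem (mem_indexList j))
    · exact List.mem_append_right _ (List.mem_map_of_mem (mem_indexList k))

theorem orderedProd_comp {f : I → M} (hf : Pairwise fun i j => Commute (f i) (f j))
    {g : J → I} (hg : g.Bijective) : orderedProd (f ∘ g) = orderedProd f := by
  rw [orderedProd_eq_of_perm hf (l := (indexList J).map g)]
  · simp [orderedProd_eq_list]
  · exact (nodup_indexList J).map hg.injective
  · intro i
    obtain ⟨j, rfl⟩ := hg.surjective i
    exact List.mem_map_of_mem (mem_indexList j)

theorem commute_orderedProd {f : I → M} {m : M} (h : ∀ i, Commute m (f i)) :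
    Commute m (orderedProd f) := by
  rw [orderedProd_eq_list]
  refine Commute.list_prod_right _ _ fun x hx => ?_
  obtain ⟨i, -, rfl⟩ := List.mem_map.1 hx
  exact h i

theorem orderedProd_one : orderedProd (fun _ : I => (1 : M)) = 1 := by
  simp [orderedProd_eq_list]

theorem orderedProd_mul {f g : I → M} (hfg : Pairwise fun i j => Commute (f i) (g j)) :
    orderedProd f * orderedProd g = orderedProd fun i => f i * g i := by
  simp only [orderedProd_eq_list]
  have key : ∀ l : List I, l.Nodup →
      (l.map f).prod * (l.map g).prod = (l.map fun i => f i * g i).prod := by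
    intro l
    induction l with
    | nil => simp
    | cons i l ih =>
      intro hl
      have hc : Commute (l.map f).prod (g i) := by
        refine (Commute.list_prod_right _ _ fun x hx => ?_).symm
        obtain ⟨j, hj, rfl⟩ := List.mem_map.1 hx
        exact (hfg (ne_of_mem_of_not_mem hj (List.nodup_cons.1 hl).1)).symm
      simp only [List.map_cons, List.prod_cons]
      rw [← ih (List.nodup_cons.1 hl).2, mul_assoc, ← mul_assoc _ (g i), hc.eq, mul_assoc,
        mul_assoc]
  exact key _ (nodup_indexList I)

theorem map_orderedProd {N F : Type*} [Monoid N] [FunLike F M N] [MonoidHomClass F M N] (φ : F)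
    (f : I → M) : φ (orderedProd f) = orderedProd fun i => φ (f i) := by
  simp [orderedProd_eq_list, map_list_prod, Function.comp_def]

theorem star_orderedProd [StarMul M] {f : I → M}
    (hf : Pairwise fun i j => Commute (f i) (f j)) :
    star (orderedProd f) = orderedProd fun i => star (f i) := by
  rw [orderedProd_eq_of_perm hf (l := (indexList I).reverse)
    (List.nodup_reverse.2 (nodup_indexList I)) (by simp [mem_indexList]), orderedProd_eq_list]
  generalize indexList I = l
  induction l with
  | nil => simp
  | cons i l ih => simp [← ih, List.map_reverse]

theorem orderedProd_eq_zero {M : Type*} [MonoidWithZero M] {f : I → M} {i : I} (h : f i = 0) :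
    orderedProd f = 0 := by
  rw [orderedProd_eq_list]
  exact List.prod_eq_zero (List.mem_map.2 ⟨i, mem_indexList i, h⟩)

theorem orderedProd_eq_single {f : I → M} {i : I} (h : ∀ j, j ≠ i → f j = 1) :
    orderedProd f = f i := by
  classical
  have hf : Pairwise fun j k => Commute (f j) (f k) := by
    intro j k hjk
    by_cases hj : j = i
    · rw [h k fun hk => hjk (hj.trans hk.symm)]
      exact Commute.one_right _
    · rw [h j hj]
      exact Commute.one_left _
  rw [orderedProd_eq_of_perm hf (l := i :: (indexList I).erase i)]
  · rw [List.map_cons, List.prod_cons, List.prod_eq_one, mul_one]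
    intro x hx
    obtain ⟨j, hj, rfl⟩ := List.mem_map.1 hx
    exact h j ((List.Nodup.mem_erase_iff (nodup_indexList I)).1 hj).1
  · exact List.nodup_cons.2 ⟨(nodup_indexList I).not_mem_erase, (nodup_indexList I).erase _⟩
  · intro j
    rw [List.mem_cons, (nodup_indexList I).mem_erase_iff]
    by_cases hj : j = i <;> simp [hj, mem_indexList]

/-- Products in a fixed order are linear in each factor, so they expand along sums. -/
theorem orderedProd_sum {M : Type*} [Ring M] [Algebra ℂ M] {κ : I → Type*} [∀ i, Fintype (κ i)]
    (c : ∀ i, κ i → ℂ) (f : ∀ i, κ i → M) :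
    (orderedProd fun i => ∑ k, c i k • f i k) =
      ∑ r : Config κ, (∏ᶠ i, c i (r i)) • orderedProd fun i => f i (r i) := by
  classical
  have := Fintype.ofFinite I
  let Φ : MultilinearMap ℂ (fun _ : I => M) M :=
    (MultilinearMap.mkPiAlgebraFin ℂ (Nat.card I) M).domDomCongr (Finite.equivFin I).symm
  have hΦ : ∀ f, orderedProd f = Φ f := fun f => by
    simp [Φ, orderedProd, MultilinearMap.domDomCongr_apply, MultilinearMap.mkPiAlgebraFin_apply]
  simp only [hΦ]
  rw [MultilinearMap.map_sum]
  refine Fintype.sum_equiv (⟨id, id, fun _ => rfl, fun _ => rfl⟩ : (∀ i, κ i) ≃ Config κ) _ _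
    fun r => ?_
  rw [MultilinearMap.map_smul_univ, finprod_eq_prod_of_fintype]
  rfl

end OrderedProd

/-! ### Matrix units -/

/-- A system of matrix units indexed by `ι` in a star-algebra `M`: elements `e i j` that multiply
and are adjoined like the matrices `|i⟩⟨j|` and whose diagonal sums to `1`. It is the same as a
unital star-homomorphism `Op ι → M`, see `MatrixUnits.hom`. -/
structure MatrixUnits (ι : Type*) [Finite ι] (M : Type*) [Ring M] [StarRing M] where
  e : ι → ι → M
  mul_same : ∀ i j k, e i j * e j k = e i k
  mul_ne : ∀ i j k l, j ≠ k → e i j * e k l = 0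
  sum_diag : ∑ᶠ i, e i i = 1
  star_e : ∀ i j, star (e i j) = e j i

namespace MatrixUnits

variable {ι : Type*} [Finite ι] {M : Type*} [Ring M] [StarRing M] (E : MatrixUnits ι M)

instance : CoeFun (MatrixUnits ι M) fun _ => ι → ι → M := ⟨MatrixUnits.e⟩

theorem mul_eq [DecidableEq ι] (i j k l : ι) : E i j * E k l = if j = k then E i l else 0 := by
  split_ifs with h
  · subst h
    exact E.mul_same i j l
  · exact E.mul_ne i j k l h

theorem sum_eq_one [Fintype ι] : ∑ i, E i i = 1 := by
  rw [← finsum_eq_sum_of_fintype, E.sum_diag]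

/-- The set of the elements of a system of matrix units. -/
def units : Set M := {m | ∃ i j, m = E i j}

/-- Transport along a bijection of the index types. -/
def reindex {κ : Type*} [Finite κ] (σ : κ ≃ ι) : MatrixUnits κ M where
  e i j := E (σ i) (σ j)
  mul_same i j k := E.mul_same _ _ _
  mul_ne i j k l h := E.mul_ne _ _ _ _ fun h' => h (σ.injective h')
  sum_diag := by
    rw [← E.sum_diag]
    exact finsum_comp_equiv σ (f := fun i => E i i)
  star_e i j := E.star_e _ _

/-- Two systems of matrix units that commute elementwise. -/
def Commutes {κ : Type*} [Finite κ] (F : MatrixUnits κ M) : Prop :=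
  ∀ i j k l, Commute (E i j) (F k l)

theorem pairwise_commute {I : Type*} {X : I → Type*} [∀ i, Finite (X i)]
    {E : ∀ i, MatrixUnits (X i) M}
    (hE : Pairwise fun i j => (E i).Commutes (E j)) (x y : ∀ i, X i) :
    Pairwise fun i j => Commute (E i (x i) (y i)) (E j (x j) (y j)) :=
  fun _ _ h => hE h _ _ _ _

section Slice

variable [Fintype ι]

/-- The coefficient of `E i j` in the expansion of `m` along the matrix units. It is an element of
the commutant of the matrix units, since `M` is the tensor product of their span with this
commutant. -/
def slice (i j : ι) (m : M) : M := ∑ r, E r i * m * E j r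

theorem commute_slice (i j k l : ι) (m : M) : Commute (E k l) (E.slice i j m) := by
  classical
  simp only [Commute, SemiconjBy, slice, Finset.mul_sum, Finset.sum_mul]
  rw [Finset.sum_eq_single l, Finset.sum_eq_single k]
  · rw [← mul_assoc, ← mul_assoc, E.mul_same, mul_assoc (E k i * m), E.mul_same]
  · intro r _ hr
    rw [mul_assoc _ (E j r), E.mul_ne _ _ _ _ hr, mul_zero]
  · simp
  · intro r _ hr
    rw [← mul_assoc, ← mul_assoc, E.mul_ne _ _ _ _ hr.symm, zero_mul, zero_mul]
  · simp

theorem commute_slice_of_commute {c m : M} (hE : ∀ i j, Commute c (E i j)) (hm : Commute c m)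
    (i j : ι) : Commute c (E.slice i j m) :=
  Commute.sum_right _ _ _ fun r _ => ((hE r i).mul_right hm).mul_right (hE j r)

theorem sum_slice_mul (m : M) : m = ∑ i, ∑ j, E.slice i j m * E i j := by
  classical
  simp only [slice, Finset.sum_mul]
  calc m = (∑ i, E i i) * m * ∑ j, E j j := by rw [E.sum_eq_one, one_mul, mul_one]
    _ = ∑ i, ∑ j, E i i * m * E j j := by
      simp only [Finset.sum_mul, Finset.mul_sum]
      exact Finset.sum_comm
    _ = _ := by
      refine Finset.sum_congr rfl fun i _ => Finset.sum_congr rfl fun j _ => ?_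
      rw [Finset.sum_eq_single i]
      · rw [mul_assoc _ (E j i), E.mul_same]
      · intro r _ hr
        rw [mul_assoc _ (E j r), E.mul_ne _ _ _ _ hr, mul_zero]
      · simp

theorem slice_sum {κ : Type*} (s : Finset κ) (i j : ι) (f : κ → M) :
    E.slice i j (∑ k ∈ s, f k) = ∑ k ∈ s, E.slice i j (f k) := by
  simp only [slice, Finset.mul_sum, Finset.sum_mul]
  exact Finset.sum_comm

end Slice

variable [Algebra ℂ M]

/-- The matrix algebra spanned by a system of matrix units. -/
def algebra : Subalgebra ℂ M := Algebra.adjoin ℂ E.units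

theorem e_mem_algebra (i j : ι) : E i j ∈ E.algebra := Algebra.subset_adjoin ⟨i, j, rfl⟩

theorem algebra_le {S : Subalgebra ℂ M} (h : ∀ i j, E i j ∈ S) : E.algebra ≤ S := by
  refine Algebra.adjoin_le ?_
  rintro _ ⟨i, j, rfl⟩
  exact h i j

theorem algebra_reindex {κ : Type*} [Finite κ] (σ : κ ≃ ι) :
    (E.reindex σ).algebra = E.algebra := by
  refine le_antisymm (algebra_le _ fun i j => E.e_mem_algebra _ _) (algebra_le _ fun i j => ?_)
  simpa [reindex] using (E.reindex σ).e_mem_algebra (σ.symm i) (σ.symm j)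

/-! ### Tensor products of commuting matrix units -/

section Tensor

variable {I : Type*} [Finite I] {X : I → Type*} [∀ i, Finite (X i)]

/-- The matrix units `⨂ i, E i (x i) (y i)` of the tensor product of pairwise commuting systems
of matrix units. -/
noncomputable def tensor (E : ∀ i, MatrixUnits (X i) M)
    (hE : Pairwise fun i j => (E i).Commutes (E j)) : MatrixUnits (Config X) M where
  e x y := orderedProd fun i => E i (x i) (y i)
  mul_same x y z := by
    refine (orderedProd_mul fun i j h => hE h _ _ _ _).trans ?_
    simp only [mul_same]
  mul_ne x y z w h := by
    refine (orderedProd_mul fun i j h => hE h _ _ _ _).trans ?_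
    obtain ⟨i, hi⟩ := Function.ne_iff.1 h
    exact orderedProd_eq_zero (i := i) ((E i).mul_ne _ _ _ _ hi)
  sum_diag := by
    have := fun i => Fintype.ofFinite (X i)
    have h := orderedProd_sum (fun i (_ : X i) => 1) fun i k => E i k k
    simp only [one_smul, sum_eq_one, orderedProd_one, finprod_one] at h
    rw [h, finsum_eq_sum_of_fintype]
  star_e x y := by
    rw [star_orderedProd (pairwise_commute hE x y)]
    simp only [star_e]

variable (E : ∀ i, MatrixUnits (X i) M) (hE : Pairwise fun i j => (E i).Commutes (E j))

theorem tensor_apply (x y : Config X) :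
    tensor E hE x y = orderedProd fun i => E i (x i) (y i) := rfl

theorem commute_tensor {c : M} (hc : ∀ i k l, Commute c (E i k l)) (x y : Config X) :
    Commute c (tensor E hE x y) :=
  commute_orderedProd fun i => hc i _ _

end Tensor

variable [StarModule ℂ M]

/-! ### The algebra of a system of matrix units -/

/-- The star-homomorphism that maps `|i⟩⟨j|` to `E i j`. -/
noncomputable def hom [Fintype ι] [DecidableEq ι] : Op ι →⋆ₐ[ℂ] M where
  toFun N := ∑ i, ∑ j, N i j • E i j
  map_one' := by
    rw [← E.sum_eq_one]
    refine Finset.sum_congr rfl fun i _ => ?_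
    rw [Finset.sum_eq_single i] <;> simp +contextual [eq_comm]
  map_mul' N N' := by
    simp only [Finset.sum_mul, Finset.mul_sum, smul_mul_smul_comm, E.mul_eq, smul_ite, smul_zero,
      Matrix.mul_apply, Finset.sum_smul]
    simp only [Finset.sum_ite_eq', Finset.mem_univ, if_true]
    exact ((Finset.sum_congr rfl fun x _ => Finset.sum_comm).trans Finset.sum_comm).trans
      (Finset.sum_congr rfl fun x _ => Finset.sum_comm)
  map_zero' := by simp
  map_add' N N' := by simp [add_smul, Finset.sum_add_distrib]
  commutes' c := by
    simp only [Algebra.algebraMap_eq_smul_one]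
    rw [← E.sum_eq_one, Finset.smul_sum]
    refine Finset.sum_congr rfl fun i _ => ?_
    rw [Finset.sum_eq_single i] <;> simp +contextual [eq_comm]
  map_star' N := by
    simp only [star_sum, star_smul, E.star_e, Matrix.star_apply]
    exact Finset.sum_comm

section Hom

variable [Fintype ι] [DecidableEq ι]

theorem hom_apply (N : Op ι) : E.hom N = ∑ i, ∑ j, N i j • E i j := rfl

theorem hom_single (i j : ι) : E.hom (Matrix.single i j 1) = E i j := by
  rw [hom_apply, Finset.sum_eq_single i, Finset.sum_eq_single j]
  · simp
  · intro k _ hk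
    simp [hk.symm]
  · simp
  · intro k _ hk
    simp [hk.symm]
  · simp

theorem slice_hom_mul (i j : ι) (N : Op ι) {m : M} (hm : ∀ k l, Commute m (E k l)) :
    E.slice i j (E.hom N * m) = N i j • m := by
  have h : ∀ r, E r i * (E.hom N * m) * E j r = N i j • (E r r * m) := by
    intro r
    rw [mul_assoc, mul_assoc, (hm j r).eq, ← mul_assoc (E.hom N), ← mul_assoc, ← smul_mul_assoc]
    congr 1
    rw [hom_apply, Finset.sum_mul, Finset.mul_sum, Finset.sum_eq_single i, Finset.sum_mul,
      Finset.mul_sum, Finset.sum_eq_single j]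
    · rw [smul_mul_assoc, mul_smul_comm, E.mul_same, E.mul_same]
    · intro k _ hk
      rw [smul_mul_assoc, E.mul_ne _ _ _ _ hk, smul_zero, mul_zero]
    · simp
    · intro k _ hk
      rw [Finset.sum_mul, Finset.mul_sum]
      refine Finset.sum_eq_zero fun l _ => ?_
      rw [smul_mul_assoc, mul_smul_comm, ← mul_assoc, E.mul_ne _ _ _ _ hk.symm, zero_mul,
        smul_zero]
    · simp
  rw [slice, Finset.sum_congr rfl fun r _ => h r, ← Finset.smul_sum, ← Finset.sum_mul,
    E.sum_eq_one, one_mul]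

theorem slice_hom (i j : ι) (N : Op ι) : E.slice i j (E.hom N) = N i j • (1 : M) := by
  simpa using E.slice_hom_mul i j N (m := 1) fun _ _ => Commute.one_left _

theorem hom_injective [Nontrivial M] : Function.Injective E.hom := by
  intro N N' h
  ext i j
  have := E.slice_hom i j N
  rw [h, E.slice_hom] at this
  exact (smul_left_injective ℂ (one_ne_zero : (1 : M) ≠ 0) this).symm

end Hom

theorem mem_algebra_iff [Fintype ι] [DecidableEq ι] {m : M} : m ∈ E.algebra ↔ ∃ N, E.hom N = m := by
  constructor
  · intro h
    have : E.algebra ≤ (E.hom : Op ι →ₐ[ℂ] M).range := by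
      refine Algebra.adjoin_le ?_
      rintro _ ⟨i, j, rfl⟩
      exact ⟨Matrix.single i j 1, E.hom_single i j⟩
    exact this h
  · rintro ⟨N, rfl⟩
    rw [hom_apply]
    exact sum_mem fun i _ => sum_mem fun j _ => Subalgebra.smul_mem _ (E.e_mem_algebra i j) _

theorem commute_of_mem_algebra {c m : M} (hc : ∀ i j, Commute c (E i j)) (hm : m ∈ E.algebra) :
    Commute c m := by
  classical
  have := Fintype.ofFinite ι
  obtain ⟨N, rfl⟩ := E.mem_algebra_iff.1 hm
  rw [hom_apply]
  exact Commute.sum_right _ _ _ fun i _ => Commute.sum_right _ _ _ fun j _ =>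
    (hc i j).smul_right _

/-- A matrix algebra has trivial centre. -/
theorem mem_bot_of_commute {m : M} (hm : m ∈ E.algebra) (hc : ∀ i j, Commute m (E i j)) :
    m ∈ (⊥ : Subalgebra ℂ M) := by
  classical
  have := Fintype.ofFinite ι
  obtain ⟨N, rfl⟩ := E.mem_algebra_iff.1 hm
  rcases isEmpty_or_nonempty ι with h | ⟨⟨i⟩⟩
  · rw [hom_apply]
    simp
  · -- The `i i` coefficient of `E.hom N = 1 * E.hom N` is read off in two ways.
    have h₁ := E.slice_hom i i N
    have h₂ := E.slice_hom_mul i i 1 hc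
    rw [map_one, one_mul, h₁, Matrix.one_apply_eq, one_smul] at h₂
    rw [← h₂, ← Algebra.algebraMap_eq_smul_one]
    exact Subalgebra.algebraMap_mem _ _

variable {I : Type*} [Finite I] {X : I → Type*} [∀ i, Finite (X i)]
  (E : ∀ i, MatrixUnits (X i) M) (hE : Pairwise fun i j => (E i).Commutes (E j))

/-- The homomorphism of a tensor product maps `⨂ i, N i` to the product of the images of the `N i`. -/
theorem tensor_hom_prod [∀ i, Fintype (X i)] [∀ i, DecidableEq (X i)] [DecidableEq (Config X)]
    (N : ∀ i, Op (X i)) :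
    (tensor E hE).hom (Matrix.of fun x y => ∏ᶠ i, N i (x i) (y i)) =
      orderedProd fun i => (E i).hom (N i) := by
  have h := orderedProd_sum (fun i (p : X i × X i) => N i p.1 p.2) fun i p => E i p.1 p.2
  simp only [Fintype.sum_prod_type] at h
  simp only [hom_apply, Matrix.of_apply]
  rw [h, ← Fintype.sum_prod_type' (f := fun x y : Config X =>
    (∏ᶠ i, N i (x i) (y i)) • tensor E hE x y)]
  refine Fintype.sum_equiv (⟨fun p i => (p.1 i, p.2 i), fun r => (fun i => (r i).1,
    fun i => (r i).2), fun _ => rfl, fun _ => rfl⟩ :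
      Config X × Config X ≃ Config fun i => X i × X i) _ _ fun p => rfl

theorem algebra_le_algebra_tensor (i : I) : (E i).algebra ≤ (tensor E hE).algebra := by
  classical
  have := fun i => Fintype.ofFinite (X i)
  refine algebra_le _ fun k l => ?_
  rw [mem_algebra_iff]
  refine ⟨_, (tensor_hom_prod E hE (Function.update (fun _ => 1) i (Matrix.single k l 1))).trans ?_⟩
  rw [orderedProd_eq_single (i := i), Function.update_self, hom_single]
  intro j hj
  rw [Function.update_of_ne hj, map_one]

end MatrixUnits

/-! ### Intersections of input and output algebras -/

section LocalAlgebra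

variable {M : Type*} [Ring M] [Algebra ℂ M] {A B : Type*}

/-- The elements that commute with all `P a`, `a ∉ α`, and all `Q b`, `b ∉ β`. If the `P a` and the
`Q b` generate the algebras of two factorisations of a matrix algebra into tensor factors, then this
is the intersection of the tensor product of the factors in `α` with that of the factors in `β`. -/
def localAlgebra (P : A → Set M) (Q : B → Set M) (α : Set A) (β : Set B) : Subalgebra ℂ M :=
  Subalgebra.centralizer ℂ ({m | ∃ a ∉ α, m ∈ P a} ∪ {m | ∃ b ∉ β, m ∈ Q b})

variable {P : A → Set M} {Q : B → Set M} {α : Set A} {β : Set B} {m : M}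

theorem mem_localAlgebra : m ∈ localAlgebra P Q α β ↔
    (∀ a ∉ α, ∀ p ∈ P a, Commute p m) ∧ ∀ b ∉ β, ∀ q ∈ Q b, Commute q m := by
  rw [localAlgebra, Subalgebra.mem_centralizer_iff]
  constructor
  · exact fun h => ⟨fun a ha p hp => h p (.inl ⟨a, ha, hp⟩),
      fun b hb q hq => h q (.inr ⟨b, hb, hq⟩)⟩
  · rintro ⟨h, h'⟩ p (⟨a, ha, hp⟩ | ⟨b, hb, hp⟩)
    exacts [h a ha p hp, h' b hb p hp]

theorem localAlgebra_swap : localAlgebra Q P β α = localAlgebra P Q α β := by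
  ext m
  rw [mem_localAlgebra, mem_localAlgebra, and_comm]

theorem localAlgebra_mono {α' : Set A} {β' : Set B} (hα : α ⊆ α') (hβ : β ⊆ β') :
    localAlgebra P Q α β ≤ localAlgebra P Q α' β' := by
  intro m hm
  rw [mem_localAlgebra] at hm ⊢
  exact ⟨fun a ha => hm.1 a fun h => ha (hα h), fun b hb => hm.2 b fun h => hb (hβ h)⟩

end LocalAlgebra

section Decomposition

variable {M : Type*} [Ring M] [StarRing M] [Algebra ℂ M]
  {A B : Type*} {X : A → Type*} [∀ a, Finite (X a)]

/-- A family of matrix units that commute with each other, and only scalars commute with all of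
them: the local matrix units of a factorisation of `M` into tensor factors. -/
structure IsFactorization (E : ∀ a, MatrixUnits (X a) M) : Prop where
  commutes : Pairwise fun a b => (E a).Commutes (E b)
  irreducible : ∀ m, (∀ a k l, Commute (E a k l) m) → m ∈ (⊥ : Subalgebra ℂ M)

namespace IsFactorization

variable {E : ∀ a, MatrixUnits (X a) M}

/-- Elements that commute with all factors are scalars, which lie in every subalgebra. -/
theorem localAlgebra_empty_le (hE : IsFactorization E) (Q : B → Set M)
    (β : Set B) (R : Subalgebra ℂ M) :
    localAlgebra (fun a => (E a).units) Q ∅ β ≤ R := by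
  intro m hm
  refine (bot_le : ⊥ ≤ R) (hE.irreducible m fun a k l => ?_)
  exact (mem_localAlgebra.1 hm).1 a (Set.notMem_empty a) _ ⟨k, l, rfl⟩

variable [Finite A]

/-- The matrix units of the tensor product of the factors in `α`. -/
noncomputable def on (hE : IsFactorization E)
    (α : Set A) : MatrixUnits (Config fun a : α => X a) M :=
  MatrixUnits.tensor (fun a : α => E a) fun _ _ h => hE.commutes fun h' => h (Subtype.ext h')

theorem commute_on (hE : IsFactorization E) {α : Set A} {c : M}
    (hc : ∀ a ∈ α, ∀ k l, Commute c (E a k l))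
    (x y : Config fun a : α => X a) : Commute c (hE.on α x y) :=
  MatrixUnits.commute_tensor _ _ (fun a : α => hc a.1 a.2) x y

variable [StarModule ℂ M]

theorem algebra_le_algebra_on (hE : IsFactorization E) {α : Set A} {a : A} (ha : a ∈ α) :
    (E a).algebra ≤ (hE.on α).algebra :=
  MatrixUnits.algebra_le_algebra_tensor (fun a : α => E a) _ ⟨a, ha⟩

/-- The tensor product of the factors in `α` is the commutant of the other factors. -/
theorem mem_algebra_on (hE : IsFactorization E) {α : Set A} {m : M}
    (hm : ∀ a ∉ α, ∀ k l, Commute (E a k l) m) :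
    m ∈ (hE.on α).algebra := by
  have := Fintype.ofFinite (Config fun a : α => X a)
  rw [(hE.on α).sum_slice_mul m]
  refine sum_mem fun x _ => sum_mem fun y _ => mul_mem ?_ ((hE.on α).e_mem_algebra x y)
  refine (bot_le : ⊥ ≤ (hE.on α).algebra) (hE.irreducible _ fun a k l => ?_)
  by_cases ha : a ∈ α
  · refine (MatrixUnits.commute_of_mem_algebra (hE.on α) (fun i j => ?_)
      (hE.algebra_le_algebra_on ha ((E a).e_mem_algebra k l))).symm
    exact ((hE.on α).commute_slice _ _ _ _ _).symm
  · refine (hE.on α).commute_slice_of_commute (fun i j => ?_) (hm a ha k l) x y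
    exact hE.commute_on (fun b hb => hE.commutes (ne_of_mem_of_not_mem hb ha).symm k l) i j

/-- Let no factor `Q b`, `b ∉ β`, meet both `α₁` and `α₂`. If `m` lies in the local algebra of
`α₁ ∪ α₂` and `β`, then the coefficients of `m` with respect to matrix units of the factors in `α₂`
lie in the local algebra of `α₁` and `β`. -/
theorem slice_mem_localAlgebra (hE : IsFactorization E) {G : A → B → Prop}
    {Q : B → Set M}
    (hQ : ∀ a b, ¬ G a b → ∀ q ∈ Q b, ∀ k l, Commute q (E a k l))
    {α₁ α₂ : Set A} {β : Set B}
    (hβ : ∀ b ∉ β, (∀ a ∈ α₁, ¬ G a b) ∨ ∀ a ∈ α₂, ¬ G a b) {m : M}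
    (hm : m ∈ localAlgebra (fun a => (E a).units) Q (α₁ ∪ α₂) β)
    [Fintype (Config fun a : α₂ => X a)] (x y : Config fun a : α₂ => X a) :
    (hE.on α₂).slice x y m ∈ localAlgebra (fun a => (E a).units) Q α₁ β := by
  rw [mem_localAlgebra] at hm ⊢
  have h₁ : ∀ a ∉ α₁, ∀ k l, Commute (E a k l) ((hE.on α₂).slice x y m) := by
    intro a ha k l
    by_cases ha' : a ∈ α₂
    · refine (MatrixUnits.commute_of_mem_algebra (hE.on α₂) (fun i j => ?_)
        (hE.algebra_le_algebra_on ha' ((E a).e_mem_algebra k l))).symm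
      exact ((hE.on α₂).commute_slice _ _ _ _ _).symm
    · refine (hE.on α₂).commute_slice_of_commute (fun i j => ?_)
        (hm.1 a (by simp [ha, ha']) _ ⟨k, l, rfl⟩) x y
      exact hE.commute_on (fun b hb => hE.commutes (ne_of_mem_of_not_mem hb ha').symm k l) i j
  refine ⟨?_, fun b hb q hq => ?_⟩
  · rintro a ha _ ⟨k, l, rfl⟩
    exact h₁ a ha k l
  · rcases hβ b hb with h | h
    · exact MatrixUnits.commute_of_mem_algebra (hE.on α₁)
        (hE.commute_on fun a ha => hQ a b (h a ha) q hq) (hE.mem_algebra_on h₁)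
    · exact (hE.on α₂).commute_slice_of_commute (hE.commute_on fun a ha => hQ a b (h a ha) q hq)
        (hm.2 b hb q hq) x y

/-- The intersection `(A₁ ⊗ A₂) ∩ B` is generated by `A₁ ∩ B` and `A₂ ∩ B` if the commutant of `B`
is generated by elements each of which acts on `A₁` only or on `A₂` only. -/
theorem localAlgebra_union_le (hE : IsFactorization E) {G : A → B → Prop}
    {Q : B → Set M}
    (hQ : ∀ a b, ¬ G a b → ∀ q ∈ Q b, ∀ k l, Commute q (E a k l))
    {α₁ α₂ : Set A} {β : Set B} (hd : Disjoint α₁ α₂)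
    (hβ : ∀ b ∉ β, (∀ a ∈ α₁, ¬ G a b) ∨ ∀ a ∈ α₂, ¬ G a b) {R : Subalgebra ℂ M}
    (h₁ : localAlgebra (fun a => (E a).units) Q α₁ β ≤ R)
    (h₂ : localAlgebra (fun a => (E a).units) Q α₂ β ≤ R) :
    localAlgebra (fun a => (E a).units) Q (α₁ ∪ α₂) β ≤ R := by
  classical
  intro m hm
  set L := localAlgebra (fun a => (E a).units) Q α₁ β
  set T₁ := hE.on α₁
  set T₂ := hE.on α₂
  have hcomm : ∀ i j k l, Commute (T₂ i j) (T₁ k l) := fun i j =>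
    hE.commute_on fun a ha k l => (hE.commute_on (fun b hb =>
      hE.commutes (hd.ne_of_mem ha hb) k l) i j).symm
  -- `φ` is a linear projection onto `A₁ ∩ B`. It is applied to the first factors of
  -- `m = ∑ (slice₂ m) * (units of A₂)`, which it fixes, after these are expanded in units of `A₁`.
  obtain ⟨φ, hφ⟩ := (LinearMap.id : L.toSubmodule →ₗ[ℂ] L.toSubmodule).exists_extend
  have hφ' : ∀ n (hn : n ∈ L), (φ n : M) = n := fun n hn =>
    congrArg Subtype.val (LinearMap.congr_fun hφ ⟨n, hn⟩)
  have hs : ∀ x y, T₂.slice x y m ∈ L := hE.slice_mem_localAlgebra hQ hβ hm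
  have hc : ∀ x y, ∃ N, T₁.hom N = T₂.slice x y m := fun x y => by
    refine T₁.mem_algebra_iff.1 (hE.mem_algebra_on fun a ha k l => ?_)
    exact (mem_localAlgebra.1 (hs x y)).1 a ha _ ⟨k, l, rfl⟩
  choose c hc using hc
  have hm' : ∀ i j, T₁.slice i j m = ∑ x, ∑ y, c x y i j • T₂ x y := by
    intro i j
    conv_lhs => rw [T₂.sum_slice_mul m]
    rw [T₁.slice_sum]
    refine Finset.sum_congr rfl fun x _ => ?_
    rw [T₁.slice_sum]
    refine Finset.sum_congr rfl fun y _ => ?_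
    rw [← hc, T₁.slice_hom_mul i j _ fun k l => hcomm x y k l]
  have key : m = ∑ i, ∑ j, (φ (T₁ i j) : M) * T₁.slice i j m := by
    calc m = ∑ x, ∑ y, (φ (T₂.slice x y m) : M) * T₂ x y := by
          conv_lhs => rw [T₂.sum_slice_mul m]
          simp only [hφ' _ (hs _ _)]
      _ = ∑ x, ∑ y, ∑ i, ∑ j, c x y i j • ((φ (T₁ i j) : M) * T₂ x y) := by
          refine Finset.sum_congr rfl fun x _ => Finset.sum_congr rfl fun y _ => ?_
          rw [← hc, T₁.hom_apply]
          simp only [map_sum, map_smul, Submodule.coe_sum, Submodule.coe_smul, Finset.sum_mul,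
            smul_mul_assoc]
      _ = ∑ p : _ × _, ∑ q : _ × _, c p.1 p.2 q.1 q.2 • ((φ (T₁ q.1 q.2) : M) * T₂ p.1 p.2) := by
          simp only [Fintype.sum_prod_type]
      _ = ∑ q : _ × _, ∑ p : _ × _, c p.1 p.2 q.1 q.2 • ((φ (T₁ q.1 q.2) : M) * T₂ p.1 p.2) := Finset.sum_comm
      _ = _ := by
          simp only [Fintype.sum_prod_type, hm', Finset.mul_sum, mul_smul_comm]
  rw [key]
  refine sum_mem fun i _ => sum_mem fun j _ => mul_mem (h₁ (φ (T₁ i j)).2) (h₂ ?_)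
  rw [Set.union_comm] at hm
  exact hE.slice_mem_localAlgebra hQ (fun b hb => (hβ b hb).symm) hm i j

/-- Let `α` be partitioned into sets `γ k` such that no `Q b`, `b ∉ β`, meets two of them. Then the
local algebra of `α` and `β` is generated by the local algebras of the `γ k` and `β`. -/
theorem localAlgebra_iUnion_le (hE : IsFactorization E) {G : A → B → Prop}
    {Q : B → Set M}
    (hQ : ∀ a b, ¬ G a b → ∀ q ∈ Q b, ∀ k l, Commute q (E a k l))
    {K : Type*} [Finite K] {γ : K → Set A} {β : Set B}
    (hd : Pairwise fun k l => Disjoint (γ k) (γ l))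
    (hβ : ∀ b ∉ β, ∀ k l, ∀ a ∈ γ k, ∀ a' ∈ γ l, G a b → G a' b → k = l) {R : Subalgebra ℂ M}
    (hR : ∀ k, localAlgebra (fun a => (E a).units) Q (γ k) β ≤ R) :
    localAlgebra (fun a => (E a).units) Q (⋃ k, γ k) β ≤ R := by
  classical
  have := Fintype.ofFinite K
  have key : ∀ J : Finset K, localAlgebra (fun a => (E a).units) Q (⋃ k ∈ J, γ k) β ≤ R := by
    intro J
    induction J using Finset.induction_on with
    | empty => simpa using hE.localAlgebra_empty_le Q β R
    | insert k J hk ih =>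
      rw [Finset.set_biUnion_insert]
      refine hE.localAlgebra_union_le hQ ?_ ?_ (hR k) ih
      · rw [Set.disjoint_iUnion₂_right]
        exact fun l hl => hd (ne_of_mem_of_not_mem hl hk).symm
      · intro b hb
        by_contra! h
        obtain ⟨⟨a, ha, hab⟩, a', ha', hab'⟩ := h
        obtain ⟨l, hl, ha'⟩ := Set.mem_iUnion₂.1 ha'
        exact hk (hβ b hb k l a ha a' ha' hab hab' ▸ hl)
  simpa using key Finset.univ

end IsFactorization

end Decomposition

/-! ### Factors are matrix algebras -/

section Factor

variable {κ : Type*} [Fintype κ]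

open ComplexOrder in
theorem star_mul_self_ne_zero {x : Op κ} (hx : x ≠ 0) : star x * x ≠ 0 := fun h =>
  hx (Matrix.conjTranspose_mul_self_eq_zero.1 h)

variable [DecidableEq κ]

/-- A star-closed algebra `S ≠ 0` of matrices contains a projection `e` with `e S e = ℂ e`. -/
theorem exists_minimal_projection [Nonempty κ] (S : Subalgebra ℂ (Op κ))
    (hS : ∀ m ∈ S, star m ∈ S) :
    ∃ e ∈ S, e ≠ 0 ∧ e * e = e ∧ star e = e ∧ ∀ a ∈ S, ∃ c : ℂ, e * a * e = c • e := by
  -- A minimal nonzero left ideal `L` of `S`.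
  let C : Set (Submodule ℂ (Op κ)) :=
    {L | L ≤ S.toSubmodule ∧ (∀ s ∈ S, ∀ y ∈ L, s * y ∈ L) ∧ L ≠ ⊥}
  have hne : C.Nonempty := by
    refine ⟨S.toSubmodule, le_rfl, fun s hs y hy => S.mul_mem hs hy, fun h => ?_⟩
    have : (1 : Op κ) ∈ S.toSubmodule := S.one_mem
    rw [h, Submodule.mem_bot] at this
    exact one_ne_zero this
  obtain ⟨L, ⟨hLS, hL, hL0⟩, hmin⟩ := wellFounded_lt.has_min C hne
  have hmin' : ∀ L' : Submodule ℂ (Op κ), L' ≤ L → (∀ s ∈ S, ∀ y ∈ L', s * y ∈ L') → L' ≠ ⊥ →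
      L' = L := by
    intro L' hle h h0
    by_contra hne
    exact hmin L' ⟨hle.trans hLS, h, h0⟩ (lt_of_le_of_ne hle hne)
  -- Schur's lemma: right multiplication by an element of `L` is a scalar on `L`.
  have schur : ∀ k ∈ L, ∃ c : ℂ, ∀ y ∈ L, y * k = c • y := by
    intro k hk
    let f : L →ₗ[ℂ] L := (LinearMap.mulRight ℂ k).restrict fun y hy => hL y (hLS hy) k hk
    have : Nontrivial L := Submodule.nontrivial_iff_ne_bot.2 hL0
    obtain ⟨c, hc⟩ := Module.End.exists_eigenvalue f
    obtain ⟨y₀, hy₀⟩ := hc.exists_hasEigenvector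
    refine ⟨c, fun y hy => ?_⟩
    let L' : Submodule ℂ (Op κ) := L ⊓ LinearMap.ker (LinearMap.mulRight ℂ k - c • LinearMap.id)
    have hL' : L' = L := by
      refine hmin' L' inf_le_left (fun s hs z hz => ⟨hL s hs z hz.1, ?_⟩) fun h => ?_
      · have := hz.2
        simp only [SetLike.mem_coe, LinearMap.mem_ker, LinearMap.sub_apply,
          LinearMap.mulRight_apply, LinearMap.smul_apply, LinearMap.id_apply, sub_eq_zero] at this ⊢
        rw [mul_assoc, this, mul_smul_comm]
      · refine hy₀.2 (Subtype.ext ((Submodule.mem_bot ℂ).1 (h ▸ ⟨y₀.2, ?_⟩)))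
        have := congrArg Subtype.val hy₀.apply_eq_smul
        have h' : (y₀ : Op κ) * k = c • (y₀ : Op κ) := this
        simp [h']
    have := (hL' ▸ hy : y ∈ L').2
    simpa [sub_eq_zero] using this
  obtain ⟨x, hx, hx0⟩ := Submodule.exists_mem_ne_zero_of_ne_bot hL0
  set q := star x * x
  have hq : q ∈ L := hL _ (hS x (hLS hx)) x hx
  have hq0 : q ≠ 0 := star_mul_self_ne_zero hx0
  have hqs : star q = q := by simp [q]
  obtain ⟨c, hc⟩ := schur q hq
  have hqq : q * q = c • q := hc q hq
  have hc0 : c ≠ 0 := by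
    rintro rfl
    rw [zero_smul] at hqq
    refine star_mul_self_ne_zero hq0 ?_
    rw [hqs, hqq]
  have hcs : star c = c := by
    have := congrArg star hqq
    rw [star_mul, hqs, star_smul, hqs, hqq] at this
    exact (smul_left_injective ℂ hq0 this).symm
  have hcs' : star c⁻¹ = c⁻¹ := by rw [star_inv₀, hcs]
  refine ⟨c⁻¹ • q, S.smul_mem (hLS hq) _, smul_ne_zero (inv_ne_zero hc0) hq0, ?_, ?_, ?_⟩
  · rw [smul_mul_smul_comm, hqq, smul_smul, mul_assoc, inv_mul_cancel₀ hc0, mul_one]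
  · rw [star_smul, hqs, hcs']
  · intro a ha
    obtain ⟨d, hd⟩ := schur (a * q) (hL a ha q hq)
    refine ⟨c⁻¹ * d, ?_⟩
    rw [smul_mul_assoc, smul_mul_assoc, mul_smul_comm, mul_assoc, hd q hq, smul_smul, smul_smul,
      smul_smul]
    congr 1
    ring

open ComplexOrder in
/-- If `star y * x ∈ ℂ e` for all `x` and `y` in `L`, where `e` is a projection, then `L` has an
orthonormal basis for the inner product thus defined. -/
theorem exists_orthonormal (e : Op κ) (he0 : e ≠ 0) (hee : e * e = e) (hes : star e = e)
    (L : Submodule ℂ (Op κ)) (hL : ∀ x ∈ L, ∀ y ∈ L, ∃ c : ℂ, star y * x = c • e)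
    (hLe : ∀ x ∈ L, x * e = x) :
    ∃ (n : ℕ) (x : Fin n → Op κ), (∀ i, x i ∈ L) ∧
      (∀ i j, star (x i) * x j = if i = j then e else 0) ∧
      ∀ z ∈ L, ∑ i, x i * star (x i) * z = z := by
  let core : InnerProductSpace.Core ℂ L :=
    { inner := fun y x => Matrix.trace (star (y : Op κ) * (x : Op κ))
      conj_inner_symm := fun x y => by
        rw [starRingEnd_apply, ← Matrix.trace_conjTranspose]
        simp [Matrix.star_eq_conjTranspose]
      re_inner_nonneg := fun x =>
        (Complex.nonneg_iff.1 (Matrix.posSemidef_conjTranspose_mul_self (x : Op κ)).trace_nonneg).1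
      add_left := fun x y z => by simp [add_mul]
      smul_left := fun x y c => by simp
      definite := fun x hx => Subtype.ext
        (Matrix.trace_conjTranspose_mul_self_eq_zero_iff.1 hx) }
  let : NormedAddCommGroup L := core.toNormedAddCommGroup
  let : InnerProductSpace ℂ L := InnerProductSpace.ofCore core.toCore
  have hinner : ∀ x y : L, inner ℂ y x = Matrix.trace (star (y : Op κ) * (x : Op κ)) := fun _ _ => rfl
  -- `τ` is the squared norm of `e`.
  obtain ⟨τ, hτ, hτe⟩ : ∃ τ : ℝ, 0 < τ ∧ Matrix.trace e = τ := by
    have h := (Matrix.posSemidef_conjTranspose_mul_self e).trace_nonneg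
    have h0 : Matrix.trace (star e * e) ≠ 0 := fun h =>
      he0 (Matrix.trace_conjTranspose_mul_self_eq_zero_iff.1 h)
    rw [← Matrix.star_eq_conjTranspose, hes, hee] at h
    rw [hes, hee] at h0
    obtain ⟨hre, him⟩ := Complex.nonneg_iff.1 h
    have hτ : Matrix.trace e = ((Matrix.trace e).re : ℂ) := Complex.ext rfl (by simpa using him.symm)
    refine ⟨_, lt_of_le_of_ne hre fun h => h0 ?_, hτ⟩
    rw [hτ, ← h, Complex.ofReal_zero]
  have hprod : ∀ x y : L, star (y : Op κ) * (x : Op κ) = (inner ℂ y x / τ) • e := by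
    intro x y
    obtain ⟨c, hc⟩ := hL x x.2 y y.2
    rw [hinner, hc, Matrix.trace_smul, hτe, smul_eq_mul, mul_div_cancel_right₀]
    exact_mod_cast hτ.ne'
  let b := stdOrthonormalBasis ℂ L
  have hr : ((Real.sqrt τ : ℝ) : ℂ) * (Real.sqrt τ : ℝ) = τ := by
    rw [← Complex.ofReal_mul, Real.mul_self_sqrt hτ.le]
  have hτ0 : (τ : ℂ) ≠ 0 := by exact_mod_cast hτ.ne'
  refine ⟨_, fun i => ((Real.sqrt τ : ℝ) : ℂ) • (b i : Op κ), fun i => L.smul_mem _ (b i).2, ?_, ?_⟩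
  · intro i j
    rw [star_smul, smul_mul_smul_comm, hprod, orthonormal_iff_ite.1 b.orthonormal, smul_smul,
      Complex.star_def, Complex.conj_ofReal, hr]
    split_ifs
    · rw [mul_one_div, div_self hτ0, one_smul]
    · simp
  · intro z hz
    have h := congrArg Subtype.val (b.sum_repr' ⟨z, hz⟩)
    rw [Submodule.coe_sum] at h
    refine (Finset.sum_congr rfl fun i _ => ?_).trans h
    rw [star_smul, smul_mul_smul_comm, Complex.star_def, Complex.conj_ofReal, hr, smul_mul_assoc,
      mul_assoc, hprod ⟨z, hz⟩, mul_smul_comm, hLe _ (b i).2, smul_smul, mul_div_cancel₀ _ hτ0]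
    rfl

/-- A star-closed algebra of matrices with trivial centre is spanned by a system of matrix units. -/
theorem exists_matrixUnits [Nonempty κ] (S : Subalgebra ℂ (Op κ)) (hS : ∀ m ∈ S, star m ∈ S)
    (hc : ∀ m ∈ S, (∀ s ∈ S, Commute s m) → m ∈ (⊥ : Subalgebra ℂ (Op κ))) :
    ∃ (n : ℕ) (E : MatrixUnits (Fin n) (Op κ)), E.algebra = S := by
  obtain ⟨e, heS, he0, hee, hes, hea⟩ := exists_minimal_projection S hS
  -- `S` acts irreducibly on the left ideal `S e`.
  let L : Submodule ℂ (Op κ) := S.toSubmodule ⊓ LinearMap.ker (LinearMap.mulRight ℂ e - LinearMap.id)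
  have hL : ∀ x, x ∈ L ↔ x ∈ S ∧ x * e = x := fun x => by
    simp [L, sub_eq_zero]
  obtain ⟨n, x, hxL, hxx, hsum⟩ := exists_orthonormal e he0 hee hes L (fun x hx y hy => by
    rw [hL] at hx hy
    obtain ⟨c, hc⟩ := hea (star y * x) (S.mul_mem (hS y hy.1) hx.1)
    refine ⟨c, ?_⟩
    rw [← hc, mul_assoc, mul_assoc, hx.2, ← mul_assoc]
    conv_lhs => rw [← hy.2, star_mul, hes]) fun x hx => ((hL x).1 hx).2
  have hxS : ∀ i, x i ∈ S := fun i => ((hL _).1 (hxL i)).1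
  have hxe : ∀ i, x i * e = x i := fun i => ((hL _).1 (hxL i)).2
  -- The projection `p` onto `S e` is central, hence equal to `1`.
  set p := ∑ i, x i * star (x i) with hp
  have hpS : p ∈ S := S.sum_mem fun i _ => S.mul_mem (hxS i) (hS _ (hxS i))
  have hpL : ∀ z ∈ L, p * z = z := fun z hz => by rw [hp, Finset.sum_mul, hsum z hz]
  have hps : star p = p := by simp [hp]
  have hpyp : ∀ y ∈ S, p * y * p = y * p := by
    intro y hy
    conv_lhs => rw [hp, Finset.mul_sum]
    conv_rhs => rw [hp, Finset.mul_sum]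
    refine Finset.sum_congr rfl fun i _ => ?_
    rw [← mul_assoc, ← mul_assoc, mul_assoc p, hpL]
    rw [hL]
    exact ⟨S.mul_mem hy (hxS i), by rw [mul_assoc, hxe]⟩
  have hp1 : p = 1 := by
    have hcomm : ∀ s ∈ S, Commute s p := by
      intro s hs
      have h := congrArg star (hpyp (star s) (hS s hs))
      rw [star_mul, star_mul, star_mul, hps, star_star, ← mul_assoc] at h
      exact (hpyp s hs).symm.trans h
    obtain ⟨c, hc⟩ := Algebra.mem_bot.1 (hc p hpS hcomm)
    have h : p * e = e := hpL e ((hL e).2 ⟨heS, hee⟩)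
    rw [← hc, Algebra.algebraMap_eq_smul_one, smul_mul_assoc, one_mul] at h
    have hc1 : c = 1 := smul_left_injective ℂ he0 (h.trans (one_smul ℂ e).symm)
    rw [← hc, hc1, map_one]
  let E : MatrixUnits (Fin n) (Op κ) :=
    { e := fun i j => x i * star (x j)
      mul_same := fun i j k => by
        rw [mul_assoc, ← mul_assoc (star (x j)), hxx, if_pos rfl, ← mul_assoc, hxe]
      mul_ne := fun i j k l h => by
        rw [mul_assoc, ← mul_assoc (star (x j)), hxx, if_neg h, zero_mul, mul_zero]
      sum_diag := by rw [finsum_eq_sum_of_fintype, ← hp, hp1]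
      star_e := fun i j => by simp }
  refine ⟨n, E, le_antisymm (E.algebra_le fun i j => S.mul_mem (hxS i) (hS _ (hxS j))) ?_⟩
  intro a ha
  have : a = ∑ i, ∑ j, x i * (star (x i) * a * x j) * star (x j) := by
    calc a = p * a * p := by rw [hp1, one_mul, mul_one]
      _ = _ := by
        simp only [hp, Finset.sum_mul, Finset.mul_sum, mul_assoc]
        exact Finset.sum_comm
  rw [this]
  refine sum_mem fun i _ => sum_mem fun j _ => ?_
  obtain ⟨c, hc⟩ := hea (star (x i) * a * x j)
    (S.mul_mem (S.mul_mem (hS _ (hxS i)) ha) (hxS j))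
  have h : star (x i) * a * x j = c • e := by
    rw [← hc]
    conv_lhs => rw [← hxe i, ← hxe j, star_mul, hes]
    simp only [mul_assoc]
  rw [h, mul_smul_comm, hxe, smul_mul_assoc]
  exact Subalgebra.smul_mem _ (E.e_mem_algebra i j) c

end Factor

/-! ### Wires of the canonical circuit shape -/

section Wires

variable {A : Type u} {B : Type v} {G : A → B → Prop}

theorem Concept.exists_not_rel_of_notMem_intent {p : Concept A B G} {b : B} (hb : b ∉ p.intent) :
    ∃ a ∈ p.extent, ¬ G a b := by
  by_contra! h
  rw [← p.upperPolar_extent] at hb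
  exact hb fun a ha => h a ha

theorem Concept.ofObject_le_iff {p : Concept A B G} {a : A} :
    Concept.ofObject G a ≤ p ↔ a ∈ p.extent :=
  Concept.ofObjects_le_iff.trans Set.singleton_subset_iff

theorem Concept.le_ofAttribute_iff {p : Concept A B G} {b : B} :
    p ≤ Concept.ofAttribute G b ↔ b ∈ p.intent :=
  Concept.le_ofAttributes_iff.trans Set.singleton_subset_iff

/-- Two concepts that share an object and an attribute are comparable. -/
theorem C3Exclusion.le_or_le (hG : C3Exclusion G) {p q : Concept A B G} {a : A} {b : B}
    (hap : a ∈ p.extent) (haq : a ∈ q.extent) (hbp : b ∈ p.intent) (hbq : b ∈ q.intent) :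
    p ≤ q ∨ q ≤ p := by
  by_contra! h
  rw [← Concept.intent_subset_intent_iff, ← Concept.intent_subset_intent_iff, Set.not_subset,
    Set.not_subset] at h
  obtain ⟨⟨b₃, hb₃q, hb₃p⟩, b₁, hb₁p, hb₁q⟩ := h
  obtain ⟨a₁, ha₁, h₁⟩ := Concept.exists_not_rel_of_notMem_intent hb₃p
  obtain ⟨a₃, ha₃, h₃⟩ := Concept.exists_not_rel_of_notMem_intent hb₁q
  have rel : ∀ {c : Concept A B G} {x y}, x ∈ c.extent → y ∈ c.intent → G x y :=
    fun hx hy => Concept.rel_extent_intent hx hy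
  exact hG a₁ a a₃ b₁ b b₃ ⟨⟨rel ha₁ hb₁p, rel ha₁ hbp, h₁⟩,
    ⟨rel hap hb₁p, rel hap hbp, rel haq hb₃q⟩, h₃, rel ha₃ hbq, rel ha₃ hb₃q⟩

/-- The wires into a box are live before the box is applied. -/
theorem live_of_target {S : CircuitShape.{u, v, w} A B} {x : S.Wire} {p : S.Box}
    (h : x.target = some p) : x.Live (LowerSet.Iio p) := by
  refine ⟨fun q hq => ?_, fun q hq hqp => ?_⟩
  · cases x with
    | input a => simp [Wire.source] at hq
    | inner r s hrs =>
      simp only [Wire.source, Wire.target, Option.some.injEq] at hq h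
      subst hq h
      exact hrs.lt
    | output b => simp [Wire.target] at h
  · rw [h, Option.some.injEq] at hq
    exact absurd hqp (hq ▸ lt_irrefl p)

/-- The wires out of a box are live after the box is applied. -/
theorem live_of_source {S : CircuitShape.{u, v, w} A B} {x : S.Wire} {p : S.Box}
    (h : x.source = some p) : x.Live (LowerSet.Iic p) := by
  cases x with
  | input a => simp [Wire.source] at h
  | inner r s hrs =>
    simp only [Wire.source, Option.some.injEq] at h
    subst h
    exact Wire.live_inner hrs
  | output b =>
    simp only [Wire.source, Option.some.injEq] at h
    exact Wire.live_output h

theorem extent_ofAttribute (b : B) : (Concept.ofAttribute G b).extent = {a | G a b} := by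
  ext a
  rw [← Concept.ofObject_le_iff, Concept.ofObject_le_ofAttribute_iff]
  rfl

theorem intent_ofObject (a : A) : (Concept.ofObject G a).intent = {b | G a b} := by
  ext b
  rw [← Concept.le_ofAttribute_iff, Concept.ofObject_le_ofAttribute_iff]
  rfl

variable [Finite A]

/-- The inputs that may influence a wire of the canonical circuit shape. -/
def wireCauses : (canonicalShape G).Wire → Set A
  | .input a => {a}
  | .inner p _ _ => Concept.extent (r := G) p
  | .output b => {a | G a b}

/-- The outputs that a wire of the canonical circuit shape may influence. -/
def wireEffects : (canonicalShape G).Wire → Set B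
  | .input a => {b | G a b}
  | .inner _ q _ => Concept.intent (r := G) q
  | .output b => {b}

theorem wireCauses_of_source {x : (canonicalShape G).Wire} {p : Concept A B G}
    (h : x.source = some p) : wireCauses x = p.extent := by
  cases x with
  | input a => simp [Wire.source] at h
  | inner p' q hpq =>
    obtain rfl : p' = p := Option.some.inj h
    rfl
  | output b =>
    obtain rfl : Concept.ofAttribute G b = p := Option.some.inj h
    exact (extent_ofAttribute b).symm

theorem wireEffects_of_target {x : (canonicalShape G).Wire} {p : Concept A B G}
    (h : x.target = some p) : wireEffects x = p.intent := by
  cases x with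
  | input a =>
    obtain rfl : Concept.ofObject G a = p := Option.some.inj h
    exact (intent_ofObject a).symm
  | inner p' q hpq =>
    obtain rfl : q = p := Option.some.inj h
    rfl
  | output b => simp [Wire.target] at h

theorem wireCauses_subset_of_target {x : (canonicalShape G).Wire} {p : Concept A B G}
    (h : x.target = some p) : wireCauses x ⊆ p.extent := by
  cases x with
  | input a =>
    obtain rfl : Concept.ofObject G a = p := Option.some.inj h
    exact Set.singleton_subset_iff.2 (Concept.ofObject_le_iff.1 le_rfl)
  | inner p' q hpq =>
    obtain rfl : q = p := Option.some.inj h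
    exact Concept.extent_subset_extent_iff.2 hpq.le
  | output b => simp [Wire.target] at h

theorem wireEffects_subset_of_source {x : (canonicalShape G).Wire} {p : Concept A B G}
    (h : x.source = some p) : wireEffects x ⊆ p.intent := by
  cases x with
  | input a => simp [Wire.source] at h
  | inner p' q hpq =>
    obtain rfl : p' = p := Option.some.inj h
    exact Concept.intent_subset_intent_iff.2 hpq.le
  | output b =>
    obtain rfl : Concept.ofAttribute G b = p := Option.some.inj h
    exact Set.singleton_subset_iff.2 (Concept.le_ofAttribute_iff.1 le_rfl)

/-- Different wires that are live at the same time have disjoint causes or disjoint effects. -/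
theorem C3Exclusion.disjoint_of_live (hG : C3Exclusion G) {T : LowerSet (canonicalShape G).Box}
    {x y : (canonicalShape G).Wire} (hx : x.Live T) (hy : y.Live T) (hxy : x ≠ y) :
    Disjoint (wireCauses x) (wireCauses y) ∨ Disjoint (wireEffects x) (wireEffects y) := by
  by_contra! h
  rw [Set.not_disjoint_iff, Set.not_disjoint_iff] at h
  obtain ⟨⟨a, hax, hay⟩, b, hbx, hby⟩ := h
  -- An input that is live and a cause of a wire out of a box in `T` would enter a box below it.
  have input_source : ∀ {a' : A} {z : (canonicalShape G).Wire}, (Wire.input a').Live T → z.Live T →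
      ∀ p : Concept A B G, z.source = some p → a' ∉ p.extent := fun h hz p hp ha =>
    h.2 _ rfl (T.lower (Concept.ofObject_le_iff.2 ha) (hz.1 p hp))
  -- Dually, a live output is not an effect of a wire into a box outside `T`.
  have output_target : ∀ {b' : B} {z : (canonicalShape G).Wire}, (Wire.output b').Live T →
      z.Live T → ∀ p : Concept A B G, z.target = some p → b' ∉ p.intent := fun h hz p hp hb =>
    hz.2 p hp (T.lower (Concept.le_ofAttribute_iff.2 hb) (h.1 _ rfl))
  cases x with
  | input a' =>
    obtain rfl : a = a' := hax
    cases y with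
    | input a' =>
      obtain rfl : a = a' := hay
      exact hxy rfl
    | inner p q h => exact input_source hx hy p rfl hay
    | output b' => exact input_source hx hy _ rfl ((extent_ofAttribute b').ge hay)
  | inner p q h =>
    cases y with
    | input a' =>
      obtain rfl : a = a' := hay
      exact input_source hy hx p rfl hax
    | inner p' q' h' =>
      have hap : a ∈ Concept.extent (r := G) p := hax
      have hap' : a ∈ Concept.extent (r := G) p' := hay
      have hbq : b ∈ Concept.intent (r := G) q := hbx
      have hbq' : b ∈ Concept.intent (r := G) q' := hby
      have haq := Concept.extent_subset_extent_iff.2 h.le hap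
      have haq' := Concept.extent_subset_extent_iff.2 h'.le hap'
      have hbp := Concept.intent_subset_intent_iff.2 h.le hbq
      have hbp' := Concept.intent_subset_intent_iff.2 h'.le hbq'
      have hpT : p ∈ T := hx.1 p rfl
      have hpT' : p' ∈ T := hy.1 p' rfl
      have hqT : q ∉ T := hx.2 q rfl
      have hqT' : q' ∉ T := hy.2 q' rfl
      -- All four boxes are comparable; a box outside `T` is not below one in `T`.
      have hpq' : p ≤ q' := (hG.le_or_le hap haq' hbp hbq').resolve_right
        fun h => hqT' (T.lower h hpT)
      have hpq : p' ≤ q := (hG.le_or_le hap' haq hbp' hbq).resolve_right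
        fun h => hqT (T.lower h hpT')
      have hne : ∀ {r s : Concept A B G}, r ∈ T → s ∉ T → r ≠ s :=
        fun hr hs h => hs (h ▸ hr)
      obtain rfl : p = p' := by
        rcases hG.le_or_le hap hap' hbp hbp' with hle | hle
        · by_contra hne'
          exact h.2 (lt_of_le_of_ne hle hne') (lt_of_le_of_ne hpq (hne hpT' hqT))
        · by_contra hne'
          exact h'.2 (lt_of_le_of_ne hle (Ne.symm hne')) (lt_of_le_of_ne hpq' (hne hpT hqT'))
      obtain rfl : q = q' := by
        rcases hG.le_or_le haq haq' hbq hbq' with hle | hle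
        · by_contra hne'
          exact h'.2 h.lt (lt_of_le_of_ne hle hne')
        · by_contra hne'
          exact h.2 h'.lt (lt_of_le_of_ne hle (Ne.symm hne'))
      exact hxy rfl
    | output b' =>
      obtain rfl : b = b' := hby
      exact output_target hy hx q rfl hbx
  | output b' =>
    obtain rfl : b = b' := hbx
    cases y with
    | input a' =>
      obtain rfl : a = a' := hay
      exact input_source hy hx _ rfl ((extent_ofAttribute b).ge hax)
    | inner p q h => exact output_target hx hy q rfl hby
    | output b' =>
      obtain rfl : b = b' := hby
      exact hxy rfl

theorem iUnion_wireCauses (p : Concept A B G) :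
    ⋃ x : {x : (canonicalShape G).Wire // x.target = some p}, wireCauses x.1 = p.extent := by
  refine subset_antisymm (Set.iUnion_subset fun x => wireCauses_subset_of_target x.2) ?_
  intro a ha
  rw [Set.mem_iUnion]
  rcases (Concept.ofObject_le_iff.2 ha).eq_or_lt with h | h
  · exact ⟨⟨.input a, congrArg some h⟩, rfl⟩
  · obtain ⟨u, hu, hup⟩ := exists_le_covBy_of_lt h
    exact ⟨⟨.inner u p hup, rfl⟩, Concept.ofObject_le_iff.1 hu⟩

theorem iUnion_wireEffects (p : Concept A B G) :
    ⋃ x : {x : (canonicalShape G).Wire // x.source = some p}, wireEffects x.1 = p.intent := by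
  refine subset_antisymm (Set.iUnion_subset fun x => wireEffects_subset_of_source x.2) ?_
  intro b hb
  rw [Set.mem_iUnion]
  rcases (Concept.le_ofAttribute_iff.2 hb).eq_or_lt with h | h
  · exact ⟨⟨.output b, congrArg some h.symm⟩, rfl⟩
  · obtain ⟨q, hpq, hq⟩ := exists_covBy_le_of_lt h
    exact ⟨⟨.inner p q hpq, rfl⟩, Concept.le_ofAttribute_iff.1 hq⟩

theorem C3Exclusion.disjoint_wireCauses (hG : C3Exclusion G) {p : Concept A B G}
    (hp : p.intent.Nonempty) : Pairwise fun x y : {x : (canonicalShape G).Wire //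
      x.target = some p} => Disjoint (wireCauses x.1) (wireCauses y.1) := by
  intro x y hxy
  refine (hG.disjoint_of_live (live_of_target x.2) (live_of_target y.2)
    fun h => hxy (Subtype.ext h)).resolve_right ?_
  rw [wireEffects_of_target x.2, wireEffects_of_target y.2, disjoint_self]
  exact hp.ne_empty

theorem C3Exclusion.disjoint_wireEffects (hG : C3Exclusion G) {p : Concept A B G}
    (hp : p.extent.Nonempty) : Pairwise fun x y : {x : (canonicalShape G).Wire //
      x.source = some p} => Disjoint (wireEffects x.1) (wireEffects y.1) := by
  intro x y hxy
  refine (hG.disjoint_of_live (live_of_source x.2) (live_of_source y.2)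
    fun h => hxy (Subtype.ext h)).resolve_left ?_
  rw [wireCauses_of_source x.2, wireCauses_of_source y.2, disjoint_self]
  exact hp.ne_empty

/-- An output that is not an effect of the box `p` is related to the causes of at most one of the
wires into `p`: all causes of `p` that it is related to are causes of the meet of `p` with the box
of the output, hence of a single wire into `p`. -/
theorem C3Exclusion.eq_of_rel_wireCauses (hG : C3Exclusion G) {p : Concept A B G}
    (hp : p.intent.Nonempty) {b : B} (hb : b ∉ p.intent)
    (x y : {x : (canonicalShape G).Wire // x.target = some p}) {a a' : A}
    (ha : a ∈ wireCauses x.1) (ha' : a' ∈ wireCauses y.1) (hab : G a b) (hab' : G a' b) :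
    x = y := by
  have hlt : Concept.ofAttribute G b ⊓ p < p :=
    lt_of_le_of_ne inf_le_right fun h => hb (Concept.le_ofAttribute_iff.1 (inf_eq_right.1 h))
  obtain ⟨u, hu, hup⟩ := exists_le_covBy_of_lt hlt
  let z : {x : (canonicalShape G).Wire // x.target = some p} := ⟨.inner u p hup, rfl⟩
  have key : ∀ (x : {x : (canonicalShape G).Wire // x.target = some p}) (a : A),
      a ∈ wireCauses x.1 → G a b → x = z := by
    intro x a ha hab
    by_contra hne
    refine Set.disjoint_left.1 (hG.disjoint_wireCauses hp hne) ha ?_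
    refine Concept.ofObject_le_iff.1 (le_trans (le_inf ?_ ?_) hu)
    · exact Concept.ofObject_le_ofAttribute_iff.2 hab
    · exact Concept.ofObject_le_iff.2 (wireCauses_subset_of_target x.2 ha)
  rw [key x a ha hab, key y a' ha' hab']

/-- An input that is not a cause of the box `p` is related to the effects of at most one of the
wires out of `p`. -/
theorem C3Exclusion.eq_of_rel_wireEffects (hG : C3Exclusion G) {p : Concept A B G}
    (hp : p.extent.Nonempty) {a : A} (ha : a ∉ p.extent)
    (x y : {x : (canonicalShape G).Wire // x.source = some p}) {b b' : B}
    (hb : b ∈ wireEffects x.1) (hb' : b' ∈ wireEffects y.1) (hab : G a b) (hab' : G a b') :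
    x = y := by
  have hlt : p < Concept.ofObject G a ⊔ p :=
    lt_of_le_of_ne le_sup_right fun h => ha (Concept.ofObject_le_iff.1 (sup_eq_right.1 h.symm))
  obtain ⟨q, hpq, hq⟩ := exists_covBy_le_of_lt hlt
  let z : {x : (canonicalShape G).Wire // x.source = some p} := ⟨.inner p q hpq, rfl⟩
  have key : ∀ (x : {x : (canonicalShape G).Wire // x.source = some p}) (b : B),
      b ∈ wireEffects x.1 → G a b → x = z := by
    intro x b hb hab
    by_contra hne
    refine Set.disjoint_left.1 (hG.disjoint_wireEffects hp hne) hb ?_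
    refine Concept.le_ofAttribute_iff.1 (le_trans hq (sup_le ?_ ?_))
    · exact Concept.ofObject_le_ofAttribute_iff.2 hab
    · exact Concept.le_ofAttribute_iff.2 (wireEffects_subset_of_source x.2 hb)
  rw [key x b hb hab, key y b' hb' hab']

end Wires

/-! ### Algebras carried by the wires -/

theorem MatrixUnits.tensor_algebra_le {M : Type*} [Ring M] [StarRing M] [Algebra ℂ M]
    {I : Type*} [Finite I] {X : I → Type*} [∀ i, Finite (X i)] (E : ∀ i, MatrixUnits (X i) M)
    (hE : Pairwise fun i j => (E i).Commutes (E j)) {R : Subalgebra ℂ M}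
    (hR : ∀ i, (E i).algebra ≤ R) : (tensor E hE).algebra ≤ R := by
  refine algebra_le _ fun x y => ?_
  rw [tensor_apply, orderedProd_eq_list]
  refine list_prod_mem fun m hm => ?_
  obtain ⟨i, -, rfl⟩ := List.mem_map.1 hm
  exact hR i ((E i).e_mem_algebra _ _)

/-- The algebra of a factor is the commutant of the other factors. -/
theorem IsFactorization.mem_algebra_iff {M : Type*} [Ring M] [StarRing M] [Algebra ℂ M]
    [StarModule ℂ M] {I : Type*} [Finite I] {X : I → Type*}
    [∀ i, Finite (X i)] {E : ∀ i, MatrixUnits (X i) M} (hE : IsFactorization E) {i : I} {m : M} :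
    m ∈ (E i).algebra ↔ ∀ j ≠ i, ∀ k l, Commute (E j k l) m := by
  refine ⟨fun hm j hj k l => (E i).commute_of_mem_algebra (hE.commutes hj k l) hm, fun hm => ?_⟩
  have h : (hE.on {i}).algebra ≤ (E i).algebra := by
    refine MatrixUnits.tensor_algebra_le _ _ fun j => ?_
    obtain ⟨j, rfl⟩ := j
    exact le_rfl
  exact h (hE.mem_algebra_on hm)

section WireAlgebra

variable {M : Type*} [Ring M] [StarRing M] [Algebra ℂ M]
  {A : Type u} {B : Type v} [Finite A] {G : A → B → Prop}
  {X : A → Type t} [∀ a, Finite (X a)] {Y : B → Type t} [∀ b, Finite (Y b)]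

/-- The local algebra of the causes and the effects of a wire. -/
def wireAlgebra (E : ∀ a, MatrixUnits (X a) M) (F : ∀ b, MatrixUnits (Y b) M)
    (x : (canonicalShape G).Wire) : Subalgebra ℂ M :=
  localAlgebra (fun a => (E a).units) (fun b => (F b).units) (wireCauses x) (wireEffects x)

/-- The local algebra of the extent and the intent of a box. -/
def boxAlgebra (E : ∀ a, MatrixUnits (X a) M) (F : ∀ b, MatrixUnits (Y b) M)
    (p : Concept A B G) : Subalgebra ℂ M :=
  localAlgebra (fun a => (E a).units) (fun b => (F b).units) p.extent p.intent

variable {E : ∀ a, MatrixUnits (X a) M} {F : ∀ b, MatrixUnits (Y b) M}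

theorem wireAlgebra_le_boxAlgebra_of_target {x : (canonicalShape G).Wire} {p : Concept A B G}
    (h : x.target = some p) : wireAlgebra E F x ≤ boxAlgebra E F p :=
  localAlgebra_mono (wireCauses_subset_of_target h) (wireEffects_of_target h).le

theorem wireAlgebra_le_boxAlgebra_of_source {x : (canonicalShape G).Wire} {p : Concept A B G}
    (h : x.source = some p) : wireAlgebra E F x ≤ boxAlgebra E F p :=
  localAlgebra_mono (wireCauses_of_source h).le (wireEffects_subset_of_source h)

theorem star_mem_wireAlgebra {x : (canonicalShape G).Wire} {m : M} (hm : m ∈ wireAlgebra E F x) :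
    star m ∈ wireAlgebra E F x := by
  rw [wireAlgebra, mem_localAlgebra] at hm ⊢
  constructor
  · rintro a ha _ ⟨i, j, rfl⟩
    rw [← (E a).star_e]
    exact (hm.1 a ha _ ⟨j, i, rfl⟩).star_star
  · rintro b hb _ ⟨i, j, rfl⟩
    rw [← (F b).star_e]
    exact (hm.2 b hb _ ⟨j, i, rfl⟩).star_star

variable [StarModule ℂ M]

theorem IsFactorization.commute_of_disjoint (hE : IsFactorization E) {B' : Type*} {Q : B' → Set M}
    {α α' : Set A} {β β' : Set B'} (hd : Disjoint α α') {m m' : M}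
    (hm : m ∈ localAlgebra (fun a => (E a).units) Q α β)
    (hm' : m' ∈ localAlgebra (fun a => (E a).units) Q α' β') : Commute m m' := by
  rw [mem_localAlgebra] at hm hm'
  refine ((hE.on α).commute_of_mem_algebra (hE.commute_on fun a ha k l => ?_)
    (hE.mem_algebra_on fun a ha k l => hm.1 a ha _ ⟨k, l, rfl⟩)).symm
  exact (hm'.1 a (Set.disjoint_left.1 hd ha) _ ⟨k, l, rfl⟩).symm

theorem IsFactorization.localAlgebra_singleton (hE : IsFactorization E)
    (hEF : ∀ a b, ¬ G a b → (E a).Commutes (F b)) (a : A) :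
    localAlgebra (fun a => (E a).units) (fun b => (F b).units) {a} {b | G a b} =
      (E a).algebra := by
  refine le_antisymm (fun m hm => ?_) ((E a).algebra_le fun i j => ?_)
  · exact hE.mem_algebra_iff.2 fun a' ha' k l => (mem_localAlgebra.1 hm).1 a' ha' _ ⟨k, l, rfl⟩
  · rw [mem_localAlgebra]
    constructor
    · rintro a' ha' _ ⟨k, l, rfl⟩
      exact hE.commutes ha' k l i j
    · rintro b hb _ ⟨k, l, rfl⟩
      exact (hEF a b hb i j k l).symm

/-- An input wire carries the factor of the input. -/
theorem wireAlgebra_input (hE : IsFactorization E)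
    (hEF : ∀ a b, ¬ G a b → (E a).Commutes (F b)) (a : A) :
    wireAlgebra E F (.input a : (canonicalShape G).Wire) = (E a).algebra :=
  hE.localAlgebra_singleton hEF a

variable [Finite B]

/-- Wires that are live at the same time carry commuting algebras. -/
theorem commute_wireAlgebra (hG : C3Exclusion G) (hE : IsFactorization E) (hF : IsFactorization F)
    {T : LowerSet (canonicalShape G).Box} {x y : (canonicalShape G).Wire} (hx : x.Live T)
    (hy : y.Live T) (hxy : x ≠ y) {m m' : M} (hm : m ∈ wireAlgebra E F x)
    (hm' : m' ∈ wireAlgebra E F y) : Commute m m' := by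
  rcases hG.disjoint_of_live hx hy hxy with h | h
  · exact hE.commute_of_disjoint h hm hm'
  · rw [wireAlgebra, ← localAlgebra_swap] at hm hm'
    exact hF.commute_of_disjoint h hm hm'

/-- The algebra of a box is generated by the algebras of the wires into it. -/
theorem boxAlgebra_le_of_target (hG : C3Exclusion G) (hE : IsFactorization E)
    (hF : IsFactorization F) (hEF : ∀ a b, ¬ G a b → (E a).Commutes (F b)) {p : Concept A B G}
    {R : Subalgebra ℂ M}
    (hR : ∀ x : (canonicalShape G).Wire, x.target = some p → wireAlgebra E F x ≤ R) :
    boxAlgebra E F p ≤ R := by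
  -- If the intent is empty, the wires into `p` may share causes, but the algebra of `p` is trivial.
  rcases p.intent.eq_empty_or_nonempty with hp | hp
  · rw [boxAlgebra, ← localAlgebra_swap, hp]
    exact hF.localAlgebra_empty_le _ _ R
  · rw [boxAlgebra, ← iUnion_wireCauses]
    refine hE.localAlgebra_iUnion_le (G := G) ?_ (hG.disjoint_wireCauses hp)
      (fun b hb x y a ha a' ha' => hG.eq_of_rel_wireCauses hp hb x y ha ha') fun x => ?_
    · rintro a b hab _ ⟨i, j, rfl⟩ k l
      exact (hEF a b hab k l i j).symm
    · rw [← wireEffects_of_target x.2]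
      exact hR x.1 x.2

/-- The algebra of a box is generated by the algebras of the wires out of it. -/
theorem boxAlgebra_le_of_source (hG : C3Exclusion G) (hE : IsFactorization E)
    (hF : IsFactorization F) (hEF : ∀ a b, ¬ G a b → (E a).Commutes (F b)) {p : Concept A B G}
    {R : Subalgebra ℂ M}
    (hR : ∀ x : (canonicalShape G).Wire, x.source = some p → wireAlgebra E F x ≤ R) :
    boxAlgebra E F p ≤ R := by
  rcases p.extent.eq_empty_or_nonempty with hp | hp
  · rw [boxAlgebra, hp]
    exact hE.localAlgebra_empty_le _ _ R
  · rw [boxAlgebra, ← localAlgebra_swap, ← iUnion_wireEffects]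
    refine hF.localAlgebra_iUnion_le (G := fun b a => G a b) ?_ (hG.disjoint_wireEffects hp)
      (fun a ha x y b hb b' hb' => hG.eq_of_rel_wireEffects hp ha x y hb hb') fun x => ?_
    · rintro b a hab _ ⟨i, j, rfl⟩ k l
      exact hEF a b hab i j k l
    · rw [localAlgebra_swap, ← wireCauses_of_source x.2]
      exact hR x.1 x.2

/-- An output wire carries the factor of the output. -/
theorem wireAlgebra_output (hF : IsFactorization F)
    (hEF : ∀ a b, ¬ G a b → (E a).Commutes (F b)) (b : B) :
    wireAlgebra E F (.output b : (canonicalShape G).Wire) = (F b).algebra :=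
  localAlgebra_swap.symm.trans (hF.localAlgebra_singleton (G := fun b a => G a b)
    (fun b a h i j k l => (hEF a b h k l i j).symm) b)

end WireAlgebra

section Existence

variable {κ : Type*} [Fintype κ] [DecidableEq κ]
  {A : Type u} {B : Type v} [Finite A] [Finite B] {G : A → B → Prop}
  {X : A → Type t} [∀ a, Finite (X a)] {Y : B → Type t} [∀ b, Finite (Y b)]
  {E : ∀ a, MatrixUnits (X a) (Op κ)} {F : ∀ b, MatrixUnits (Y b) (Op κ)}

theorem MatrixUnits.nonempty {M : Type*} [Ring M] [StarRing M] [Nontrivial M] {ι : Type*}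
    [Finite ι] (E : MatrixUnits ι M) : Nonempty ι := by
  by_contra h
  rw [not_nonempty_iff] at h
  exact one_ne_zero (α := M) (by rw [← E.sum_diag, finsum_of_isEmpty])

/-- A central element of the algebra of a box is scalar if the wires into the box carry matrix
algebras. -/
theorem mem_bot_of_mem_boxAlgebra (hG : C3Exclusion G) (hE : IsFactorization E)
    (hF : IsFactorization F) (hEF : ∀ a b, ¬ G a b → (E a).Commutes (F b)) {p : Concept A B G}
    {ι : {x : (canonicalShape G).Wire // x.target = some p} → Type*} [hι : ∀ x, Finite (ι x)]
    (W : ∀ x, MatrixUnits (ι x) (Op κ)) (hW : ∀ x, (W x).algebra = wireAlgebra E F x.1)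
    {m : Op κ} (hm : m ∈ boxAlgebra E F p) (hc : ∀ s ∈ boxAlgebra E F p, Commute s m) :
    m ∈ (⊥ : Subalgebra ℂ (Op κ)) := by
  have hcomm : Pairwise fun x y => (W x).Commutes (W y) := fun x y hxy i j k l =>
    commute_wireAlgebra hG hE hF (live_of_target x.2) (live_of_target y.2)
      (fun h => hxy (Subtype.ext h)) (hW x ▸ (W x).e_mem_algebra i j)
      (hW y ▸ (W y).e_mem_algebra k l)
  refine (MatrixUnits.tensor W hcomm).mem_bot_of_commute ?_ fun i j => ?_
  · refine boxAlgebra_le_of_target hG hE hF hEF (fun x hx => ?_) hm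
    rw [← hW ⟨x, hx⟩]
    exact MatrixUnits.algebra_le_algebra_tensor W hcomm _
  · refine MatrixUnits.commute_tensor W hcomm (fun x k l => (hc _ ?_).symm) i j
    exact wireAlgebra_le_boxAlgebra_of_target x.2 (hW x ▸ (W x).e_mem_algebra k l)

/-- Every inner wire carries a matrix algebra. The induction goes upwards along the boxes: if the
wires into `p` carry matrix algebras, then so does `p`, whose algebra is the tensor product of
theirs; and a wire out of `p` carries a tensor factor of this algebra. -/
theorem exists_matrixUnits_inner [Nonempty κ] (hG : C3Exclusion G) (hE : IsFactorization E)
    (hF : IsFactorization F) (hEF : ∀ a b, ¬ G a b → (E a).Commutes (F b))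
    (p q : (canonicalShape G).Box) (hpq : p ⋖ q) :
    ∃ (n : ℕ) (W : MatrixUnits (Fin n) (Op κ)), W.algebra = wireAlgebra E F (.inner p q hpq) := by
  induction p using WellFoundedLT.induction generalizing q with
  | ind p ih =>
    have hinto : ∀ x : {x : (canonicalShape G).Wire // x.target = some p},
        ∃ (ι : Type t) (_ : Finite ι) (W : MatrixUnits ι (Op κ)),
          W.algebra = wireAlgebra E F x.1 := by
      rintro ⟨x, hx⟩
      cases x with
      | input a => exact ⟨X a, inferInstance, E a, (wireAlgebra_input hE hEF a).symm⟩
      | inner u v huv =>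
        obtain rfl : v = p := Option.some.inj hx
        obtain ⟨n, W, hW⟩ := ih u huv.lt v huv
        exact ⟨ULift (Fin n), inferInstance, W.reindex Equiv.ulift,
          (W.algebra_reindex _).trans hW⟩
      | output b => cases hx
    choose ι hι W hW using hinto
    let x₀ : (canonicalShape G).Wire := .inner p q hpq
    have hx₀ : x₀.source = some p := rfl
    -- A central element of the wire algebra commutes with the algebras of all wires out of `p`, hence
    -- with the algebra of `p`, whose centre is trivial.
    refine exists_matrixUnits (wireAlgebra E F x₀) (fun m hm => star_mem_wireAlgebra hm)
      fun m hm hc => ?_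
    refine mem_bot_of_mem_boxAlgebra (hι := hι) hG hE hF hEF W hW
      (wireAlgebra_le_boxAlgebra_of_source hx₀ hm) fun s hs => ?_
    have h : boxAlgebra E F p ≤ Subalgebra.centralizer ℂ {m} := by
      refine boxAlgebra_le_of_source hG hE hF hEF fun x hx s hs => ?_
      rw [Subalgebra.mem_centralizer_iff]
      rintro _ rfl
      by_cases hxx : x = x₀
      · subst hxx
        exact (hc s hs).symm
      · exact (commute_wireAlgebra hG hE hF (live_of_source hx) (live_of_source hx₀) hxx hs hm).symm
    exact ((Subalgebra.mem_centralizer_iff ℂ).1 (h hs) m rfl).symm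

end Existence

/-! ### Composition of gates -/

namespace UnitaryCircuit

section Extension

variable {A : Type u} {B : Type v} {S : CircuitShape.{u, v, w} A B}

/-- The set `T` consists of the lower set `T₀` and of one further box `p`. -/
structure IsExtension (T₀ T : LowerSet S.Box) (p : S.Box) : Prop where
  mem_iff : ∀ q, q ∈ T ↔ q ∈ T₀ ∨ q = p
  notMem : p ∉ T₀

namespace IsExtension

variable {T₀ T : LowerSet S.Box} {p : S.Box}

theorem mem (h : IsExtension T₀ T p) : p ∈ T := (h.mem_iff p).2 (.inr rfl)

theorem mem_of_mem (h : IsExtension T₀ T p) {q : S.Box} (hq : q ∈ T₀) : q ∈ T :=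
  (h.mem_iff q).2 (.inl hq)

theorem past_of_past (h : IsExtension T₀ T p) {x : S.Wire} (hx : x.Past T₀) : x.Past T :=
  fun q hq => h.mem_of_mem (hx q hq)

theorem past_of_source_ne (h : IsExtension T₀ T p) {x : S.Wire} (hx : x.Past T)
    (hp : x.source ≠ some p) : x.Past T₀ := fun q hq =>
  ((h.mem_iff q).1 (hx q hq)).resolve_right fun hqp => hp (hqp ▸ hq)

theorem source_ne_of_past (h : IsExtension T₀ T p) {x : S.Wire} (hx : x.Past T₀) :
    x.source ≠ some p := fun hp => h.notMem (hx p hp)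

theorem past_of_target (h : IsExtension T₀ T p) {x : S.Wire} (hx : x.target = some p) :
    x.Past T₀ := by
  intro q hq
  have hlt : q < p := (live_of_target hx).1 q hq
  exact ((h.mem_iff q).1 (T.lower hlt.le h.mem)).resolve_right hlt.ne

theorem live_of_live (h : IsExtension T₀ T p) {x : S.Wire} (hx : x.Live T₀)
    (hp : x.target ≠ some p) : x.Live T :=
  ⟨h.past_of_past hx.1, fun q hq hqT => ((h.mem_iff q).1 hqT).elim (hx.2 q hq)
    fun hqp => hp (hqp ▸ hq)⟩

theorem live_of_source_ne (h : IsExtension T₀ T p) {x : S.Wire} (hx : x.Live T)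
    (hp : x.source ≠ some p) : x.Live T₀ :=
  ⟨h.past_of_source_ne hx.1 hp, fun q hq hqT => hx.2 q hq (h.mem_of_mem hqT)⟩

theorem live_into (h : IsExtension T₀ T p) {x : S.Wire} (hx : x.target = some p) : x.Live T₀ := by
  refine ⟨h.past_of_target hx, fun q hq hqT => h.notMem ?_⟩
  rw [hx, Option.some.injEq] at hq
  exact hq ▸ hqT

theorem live_outOf (h : IsExtension T₀ T p) {x : S.Wire} (hx : x.source = some p) : x.Live T := by
  refine ⟨Wire.past_of_source h.mem hx, fun q hq hqT => ?_⟩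
  have hle : p ≤ q := by
    cases x with
    | input a => cases hx
    | inner r s hrs =>
      obtain rfl : r = p := Option.some.inj hx
      obtain rfl : s = q := Option.some.inj hq
      exact hrs.le
    | output b => cases hq
  rcases (h.mem_iff q).1 hqT with hq' | rfl
  · exact h.notMem (T₀.lower hle hq')
  · exact (live_of_source hx).2 q hq (LowerSet.mem_Iic_iff.2 le_rfl)

theorem target_ne (h : IsExtension T₀ T p) {x : S.Wire} (hx : x.Live T) : x.target ≠ some p :=
  fun hp => hx.2 p hp h.mem

/-- The boxes in `T` are those in `T₀` and `p`. -/
noncomputable def boxEquiv (h : IsExtension T₀ T p) :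
    Option {q : S.Box // q ∈ T₀} ≃ {q : S.Box // q ∈ T} :=
  Equiv.ofBijective (fun o => o.elim ⟨p, h.mem⟩ fun q => ⟨q.1, h.mem_of_mem q.2⟩) <| by
    constructor
    · rintro (_ | q) (_ | r) hqr
      · rfl
      · exact (h.notMem (Subtype.mk.inj hqr ▸ r.2)).elim
      · exact (h.notMem (Subtype.mk.inj hqr ▸ q.2)).elim
      · exact congrArg some (Subtype.ext (Subtype.mk.inj hqr))
    · rintro ⟨q, hq⟩
      rcases (h.mem_iff q).1 hq with hq' | rfl
      · exact ⟨some ⟨q, hq'⟩, rfl⟩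
      · exact ⟨none, rfl⟩

theorem finprod_eq (h : IsExtension T₀ T p) (f : {q : S.Box // q ∈ T} → ℂ) :
    ∏ᶠ q, f q = f ⟨p, h.mem⟩ * ∏ᶠ q : {q : S.Box // q ∈ T₀}, f ⟨q.1, h.mem_of_mem q.2⟩ := by
  have := Fintype.ofFinite {q : S.Box // q ∈ T₀}
  rw [← finprod_comp_equiv h.boxEquiv, finprod_eq_prod_of_fintype, Fintype.prod_option,
    ← finprod_eq_prod_of_fintype]
  rfl

end IsExtension

end Extension

end UnitaryCircuit

theorem sum_sum_comm {M : Type*} [AddCommMonoid M] {ι κ : Type*} [Fintype ι] [Fintype κ]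
    (f : ι → ι → κ → κ → M) :
    ∑ i, ∑ i', ∑ k, ∑ k', f i i' k k' = ∑ k, ∑ k', ∑ i, ∑ i', f i i' k k' := by
  have h := Finset.sum_comm (s := Finset.univ) (t := Finset.univ)
    (f := fun (p : ι × ι) (q : κ × κ) => f p.1 p.2 q.1 q.2)
  simpa only [Fintype.sum_prod_type] using h

section Compose

variable {A : Type u} {B : Type v} [Finite A] [Finite B] {S : CircuitShape.{u, v, w} A B}
  {X : A → Type t} {Y : B → Type t} [∀ a, Finite (X a)] [∀ b, Finite (Y b)]
  {C : UnitaryCircuit S X Y}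

namespace UnitaryCircuit

namespace IsExtension

variable {T₀ T : LowerSet S.Box} {p : S.Box}

open Classical in
/-- A history of `T₀` together with labels of the wires out of `p` is a history of `T`. -/
noncomputable def extend (h : IsExtension T₀ T p) (z : C.Hist T₀)
    (o : Config fun x : {x : S.Wire // x.source = some p} => C.sys x.1) : C.Hist T :=
  fun x => if hx : x.1.source = some p then o ⟨x.1, hx⟩ else z ⟨x.1, h.past_of_source_ne x.2 hx⟩

theorem extend_of_source (h : IsExtension T₀ T p) (z : C.Hist T₀)
    (o : Config fun x : {x : S.Wire // x.source = some p} => C.sys x.1)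
    (x : {x : S.Wire // x.Past T}) (hx : x.1.source = some p) :
    h.extend z o x = o ⟨x.1, hx⟩ := dif_pos hx

theorem extend_of_past (h : IsExtension T₀ T p) (z : C.Hist T₀)
    (o : Config fun x : {x : S.Wire // x.source = some p} => C.sys x.1)
    (x : {x : S.Wire // x.Past T}) (hx : x.1.Past T₀) :
    h.extend z o x = z ⟨x.1, hx⟩ := dif_neg (h.source_ne_of_past hx)

/-- The labels of the wires into `p` in a history of `T₀`. -/
def entering (h : IsExtension T₀ T p) (z : C.Hist T₀) :
    Config fun x : {x : S.Wire // x.target = some p} => C.sys x.1 :=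
  fun x => z ⟨x.1, h.past_of_target x.2⟩

/-- Histories of `T` are histories of `T₀` together with labels of the wires out of `p`. -/
noncomputable def histEquiv (h : IsExtension T₀ T p) :
    C.Hist T₀ × (Config fun x : {x : S.Wire // x.source = some p} => C.sys x.1) ≃ C.Hist T where
  toFun z := h.extend z.1 z.2
  invFun z := (fun x => z ⟨x.1, h.past_of_past x.2⟩, z.outOf h.mem)
  left_inv z := by
    refine Prod.ext (funext fun x => ?_) (funext fun x => ?_)
    · exact h.extend_of_past z.1 z.2 _ x.2
    · exact h.extend_of_source z.1 z.2 _ x.2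
  right_inv z := by
    funext x
    by_cases hx : x.1.source = some p
    · exact h.extend_of_source _ _ x hx
    · exact h.extend_of_past _ _ x (h.past_of_source_ne x.2 hx)

end IsExtension

variable {M : Type*} [Ring M] [StarRing M] [Algebra ℂ M]

/-- The contribution of a pair of histories to the composite of the gates in `T`. -/
noncomputable def amplitude {T : LowerSet S.Box} (z z' : C.Hist T) : ℂ :=
  ∏ᶠ p : {p : S.Box // p ∈ T},
    coeff (C.gate p.1) (z.outOf p.2) (z'.outOf p.2) (z.into p.2) (z'.into p.2)

theorem amplitude_extend {T₀ T : LowerSet S.Box} {p : S.Box} (h : IsExtension T₀ T p)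
    (z z' : C.Hist T₀)
    (o o' : Config fun x : {x : S.Wire // x.source = some p} => C.sys x.1) :
    amplitude (h.extend z o) (h.extend z' o') =
      coeff (C.gate p) o o' (h.entering z)
        (h.entering z') * amplitude z z' := by
  have hout : ∀ (z : C.Hist T₀) o, (h.extend z o).outOf h.mem = o := fun z o =>
    funext fun x => h.extend_of_source z o _ x.2
  have hin : ∀ (z : C.Hist T₀) o, (h.extend z o).into h.mem =
      h.entering z := fun z o =>
    funext fun x => h.extend_of_past z o ⟨x.1, _⟩ (h.past_of_target x.2)
  have hout' : ∀ (z : C.Hist T₀) o {q} (hq : q ∈ T₀),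
      (h.extend z o).outOf (h.mem_of_mem hq) = z.outOf hq := fun z o q hq =>
    funext fun x => h.extend_of_past z o _ (Wire.past_of_source hq x.2)
  have hin' : ∀ (z : C.Hist T₀) o {q} (hq : q ∈ T₀),
      (h.extend z o).into (h.mem_of_mem hq) = z.into hq := fun z o q hq =>
    funext fun x => h.extend_of_past z o _ (Wire.past_of_target hq x.2)
  rw [amplitude, h.finprod_eq, hout, hout, hin, hin]
  congr 1
  exact finprod_congr fun q => by rw [hout' z o q.2, hout' z' o' q.2, hin' z o q.2, hin' z' o' q.2]

/-- Matrix units in `M` for the systems on all wires of a circuit, such that wires that are live at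
the same time carry commuting systems. -/
structure WireUnits (C : UnitaryCircuit S X Y) (M : Type*) [Ring M] [StarRing M] where
  units : ∀ x : S.Wire, MatrixUnits (C.sys x) M
  commutes : ∀ (T : LowerSet S.Box) (x y : S.Wire), x.Live T → y.Live T → x ≠ y →
    (units x).Commutes (units y)

namespace WireUnits

variable (W : WireUnits C M)

/-- The matrix units of the systems that are live once the boxes in `T` have been applied. -/
noncomputable def live (T : LowerSet S.Box) : MatrixUnits (Config (C.liveSys T)) M :=
  MatrixUnits.tensor (fun x : {x : S.Wire // x.Live T} => W.units x.1) fun x y hxy =>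
    W.commutes T x.1 y.1 x.2 y.2 fun h => hxy (Subtype.ext h)

/-- The matrix units of the system that goes into the box `p`. -/
noncomputable def into (p : S.Box) :
    MatrixUnits (Config fun x : {x : S.Wire // x.target = some p} => C.sys x.1) M :=
  MatrixUnits.tensor (fun x : {x : S.Wire // x.target = some p} => W.units x.1) fun x y hxy =>
    W.commutes (LowerSet.Iio p) x.1 y.1 (live_of_target x.2) (live_of_target y.2)
      fun h => hxy (Subtype.ext h)

/-- The matrix units of the system that comes out of the box `p`. -/
noncomputable def outOf (p : S.Box) :
    MatrixUnits (Config fun x : {x : S.Wire // x.source = some p} => C.sys x.1) M :=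
  MatrixUnits.tensor (fun x : {x : S.Wire // x.source = some p} => W.units x.1) fun x y hxy =>
    W.commutes (LowerSet.Iic p) x.1 y.1 (live_of_source x.2) (live_of_source y.2)
      fun h => hxy (Subtype.ext h)

/-- Every gate of the circuit is the identity of `M`, read in the matrix units of the wires into
and out of its box. -/
def Compatible : Prop :=
  ∀ (p : S.Box) (j j' : Config fun x : {x : S.Wire // x.target = some p} => C.sys x.1),
    W.into p j j' = ∑ o, ∑ o', coeff (C.gate p) o o' j j' • W.outOf p o o'

variable {W}

/-- One step of the composition: the gate of `p` replaces the wires into `p` by those out of `p`. -/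
theorem sum_coeff_smul_live (hW : W.Compatible) {T₀ T : LowerSet S.Box} {p : S.Box}
    (h : IsExtension T₀ T p) (z z' : C.Hist T₀) :
    ∑ o, ∑ o', coeff (C.gate p) o o' (h.entering z)
        (h.entering z') •
          W.live T (h.extend z o).live (h.extend z' o').live =
      W.live T₀ z.live z'.live := by
  let R := {x : S.Wire // x.Live T₀ ∧ x.target ≠ some p}
  let r : R → M := fun x => W.units x.1 (z ⟨x.1, x.2.1.1⟩) (z' ⟨x.1, x.2.1.1⟩)
  have hT : ∀ o o', W.live T (h.extend z o).live (h.extend z' o').live =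
      orderedProd r * W.outOf p o o' := by
    intro o o'
    let g : R → {x : S.Wire // x.Live T} := fun x => ⟨x.1, h.live_of_live x.2.1 x.2.2⟩
    let k : {x : S.Wire // x.source = some p} → {x : S.Wire // x.Live T} :=
      fun x => ⟨x.1, h.live_outOf x.2⟩
    refine (orderedProd_eq_mul (g := g) (h := k) (fun x y hxy => W.commutes T x.1 y.1 x.2 y.2
      (fun h => hxy (Subtype.ext h)) _ _ _ _) ?_ ?_ ?_ ?_).trans ?_
    · exact fun x y hxy => Subtype.ext (Subtype.mk.inj hxy)
    · exact fun x y hxy => Subtype.ext (Subtype.mk.inj hxy)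
    · intro x y hxy
      have hxy' : x.1 = y.1 := Subtype.mk.inj hxy
      exact h.source_ne_of_past x.2.1.1 (hxy' ▸ y.2)
    · intro x
      by_cases hx : x.1.source = some p
      · exact .inr ⟨⟨x.1, hx⟩, rfl⟩
      · exact .inl ⟨⟨x.1, h.live_of_source_ne x.2 hx, h.target_ne x.2⟩, rfl⟩
    · refine congrArg₂ (· * ·) (congrArg orderedProd (funext fun x => ?_))
        (congrArg orderedProd (funext fun x => ?_) : _ =
          orderedProd fun x : {x : S.Wire // x.source = some p} => W.units x.1 (o x) (o' x))
      · exact congrArg₂ (W.units x.1).e (h.extend_of_past z o _ x.2.1.1)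
          (h.extend_of_past z' o' _ x.2.1.1)
      · exact congrArg₂ (W.units x.1).e (h.extend_of_source z o _ x.2)
          (h.extend_of_source z' o' _ x.2)
  have hT₀ : W.live T₀ z.live z'.live = orderedProd r *
      W.into p (h.entering z)
        (h.entering z') := by
    let g : R → {x : S.Wire // x.Live T₀} := fun x => ⟨x.1, x.2.1⟩
    let k : {x : S.Wire // x.target = some p} → {x : S.Wire // x.Live T₀} :=
      fun x => ⟨x.1, h.live_into x.2⟩
    refine orderedProd_eq_mul (g := g) (h := k) (fun x y hxy => W.commutes T₀ x.1 y.1 x.2 y.2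
      (fun h => hxy (Subtype.ext h)) _ _ _ _) ?_ ?_ ?_ ?_
    · exact fun x y hxy => Subtype.ext (Subtype.mk.inj hxy)
    · exact fun x y hxy => Subtype.ext (Subtype.mk.inj hxy)
    · intro x y hxy
      have hxy' : x.1 = y.1 := Subtype.mk.inj hxy
      exact x.2.2 (hxy' ▸ y.2)
    · intro x
      by_cases hx : x.1.target = some p
      · exact .inr ⟨⟨x.1, hx⟩, rfl⟩
      · exact .inl ⟨⟨x.1, x.2, hx⟩, rfl⟩
  rw [hT₀, hW p]
  simp only [hT, Finset.mul_sum, mul_smul_comm]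

open Classical in
/-- The sum over histories does not depend on `T`, since the boxes can be removed one by one. -/
theorem sum_amplitude_smul_live (hW : W.Compatible) (T : LowerSet S.Box) (i i' : Config X) :
    (∑ z : C.Hist T, ∑ z' : C.Hist T, if z.inputs = i ∧ z'.inputs = i' then
      amplitude z z' • W.live T z.live z'.live else 0) =
      orderedProd fun a => W.units (.input a) (i a) (i' a) := by
  induction T using WellFoundedLT.induction with
  | ind T ih =>
  rcases (T : Set S.Box).eq_empty_or_nonempty with hT | hT
  · -- Without boxes, a history consists of the input labels only.
    have hbox : ∀ q, q ∉ T := fun q hq => (Set.eq_empty_iff_forall_notMem.1 hT q) hq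
    have hpast : ∀ x : S.Wire, x.Past T → ∃ a, .input a = x := by
      intro x hx
      cases x with
      | input a => exact ⟨a, rfl⟩
      | inner p q h => exact (hbox p (hx p rfl)).elim
      | output b => exact (hbox _ (hx _ rfl)).elim
    let g : A → {x : S.Wire // x.Live T} := fun a =>
      ⟨.input a, Wire.past_input T a, fun q _ => hbox q⟩
    have hg : g.Bijective := by
      refine ⟨fun a b hab => ?_, fun x => ?_⟩
      · exact Wire.input.inj (Subtype.mk.inj hab)
      · obtain ⟨a, ha⟩ := hpast x.1 x.2.1
        exact ⟨a, Subtype.ext ha⟩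
    have hinj : ∀ z z' : C.Hist T, z.inputs = z'.inputs → z = z' := by
      intro z z' h
      funext ⟨x, hx⟩
      obtain ⟨a, rfl⟩ := hpast x hx
      exact congrFun h a
    have hex : ∀ i : Config X, ∃ z : C.Hist T, z.inputs = i := by
      intro i
      refine ⟨fun x => match x with
        | ⟨.input a, _⟩ => i a
        | ⟨.inner p q h, hx⟩ => (hbox p (hx p rfl)).elim
        | ⟨.output b, hx⟩ => (hbox _ (hx _ rfl)).elim, rfl⟩
    obtain ⟨z, rfl⟩ := hex i
    obtain ⟨z', rfl⟩ := hex i'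
    rw [Finset.sum_eq_single z, Finset.sum_eq_single z', if_pos ⟨rfl, rfl⟩]
    · have : IsEmpty {p : S.Box // p ∈ T} := ⟨fun p => hbox p.1 p.2⟩
      rw [amplitude, finprod_of_isEmpty, one_smul]
      exact (orderedProd_comp (g := g) (fun x y hxy => W.commutes T x.1 y.1 x.2 y.2
        (fun h => hxy (Subtype.ext h)) _ _ _ _) hg).symm
    · exact fun y _ hy => if_neg fun h => hy (hinj _ _ h.2)
    · simp
    · exact fun y _ hy => Finset.sum_eq_zero fun y' _ => if_neg fun h => hy (hinj _ _ h.1)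
    · simp
  · obtain ⟨p, hpT, hp⟩ := (T : Set S.Box).toFinite.exists_maximal hT
    have hmax : ∀ q ∈ T, p ≤ q → q = p := fun q hq hpq => le_antisymm (hp hq hpq) hpq
    have h : IsExtension (T.erase p) T p := by
      refine ⟨fun q => ?_, fun h => ?_⟩
      · rw [← SetLike.mem_coe (p := T.erase p), LowerSet.coe_erase]
        refine ⟨fun hq => ?_, ?_⟩
        · by_cases hpq : p ≤ q
          · exact .inr (hmax q hq hpq)
          · exact .inl ⟨hq, hpq⟩
        · rintro (hq | rfl)
          · exact hq.1
          · exact hpT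
      · rw [← SetLike.mem_coe, LowerSet.coe_erase] at h
        exact h.2 le_rfl
    rw [← ih (T.erase p) (LowerSet.erase_lt.2 hpT)]
    have hinputs : ∀ (z : C.Hist (T.erase p)) o, (h.extend z o).inputs = z.inputs := fun z o =>
      funext fun a => h.extend_of_past z o _ (Wire.past_input _ a)
    have hsum : ∀ f : C.Hist T → M, ∑ z, f z = ∑ z, ∑ o, f (h.extend z o) := fun f => by
      rw [← Fintype.sum_prod_type']
      exact (Fintype.sum_equiv h.histEquiv _ _ fun _ => rfl).symm
    rw [hsum]
    refine Finset.sum_congr rfl fun z _ => ?_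
    simp only [hsum (fun z' => ite _ _ _)]
    rw [Finset.sum_comm]
    refine Finset.sum_congr rfl fun z' _ => ?_
    simp only [hinputs]
    split_ifs with hz
    · rw [← sum_coeff_smul_live hW h z z', Finset.smul_sum]
      refine Finset.sum_congr rfl fun o _ => ?_
      rw [Finset.smul_sum]
      refine Finset.sum_congr rfl fun o' _ => ?_
      rw [amplitude_extend, smul_smul, mul_comm]
    · simp

open Classical in
/-- In the matrix units of the live wires, the composite of the gates in `T` is the identity. -/
theorem sum_compose_smul_live (hW : W.Compatible) (T : LowerSet S.Box) (N : Op (Config X)) :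
    ∑ o, ∑ o', C.compose T N o o' • W.live T o o' =
      ∑ i, ∑ i', N i i' • orderedProd fun a => W.units (.input a) (i a) (i' a) := by
  have h : ∀ o o', C.compose T N o o' = ∑ i, ∑ i', (∑ z : C.Hist T, ∑ z' : C.Hist T,
      if z.inputs = i ∧ z'.inputs = i' ∧ z.live = o ∧ z'.live = o' then amplitude z z' else 0) *
        N i i' := fun o o' => rfl
  have hsum : ∀ i i', (∑ o, ∑ o', (∑ z : C.Hist T, ∑ z' : C.Hist T,
      if z.inputs = i ∧ z'.inputs = i' ∧ z.live = o ∧ z'.live = o' then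
        amplitude z z' else 0) • W.live T o o') =
      orderedProd fun a => W.units (.input a) (i a) (i' a) := by
    intro i i'
    rw [← sum_amplitude_smul_live hW T]
    simp only [Finset.sum_smul]
    calc _ = ∑ z : C.Hist T, ∑ z' : C.Hist T, ∑ o, ∑ o',
          (if z.inputs = i ∧ z'.inputs = i' ∧ z.live = o ∧ z'.live = o' then
            amplitude z z' else 0) • W.live T o o' := by
          exact sum_sum_comm _
      _ = _ := by
          refine Finset.sum_congr rfl fun z _ => Finset.sum_congr rfl fun z' _ => ?_
          rw [Finset.sum_eq_single z.live, Finset.sum_eq_single z'.live]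
          · simp [ite_smul]
          · exact fun o _ ho => by rw [if_neg fun h => ho h.2.2.2.symm, zero_smul]
          · simp
          · exact fun o _ ho => Finset.sum_eq_zero fun o' _ => by
              rw [if_neg fun h => ho h.2.2.1.symm, zero_smul]
          · simp
  simp only [← hsum, h, Finset.sum_smul (s := Finset.univ (α := Config X)), Finset.smul_sum,
    smul_smul, mul_comm (N _ _)]
  exact sum_sum_comm _

end WireUnits

end UnitaryCircuit

end Compose

/-! ### Local operators of a composite system -/

section LocalOps

variable {I : Type u} {X : I → Type t}

open Classical in
/-- The operator `|k⟩⟨l|` on the factor `i` of a composite system. -/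
noncomputable def localUnit (i : I) (k l : X i) : Op (Config X) :=
  Matrix.of fun p q => if p i = k ∧ q i = l ∧ ∀ j, j ≠ i → p j = q j then 1 else 0

open Classical in
theorem localUnit_apply (i : I) (k l : X i) (p q : Config X) : localUnit i k l p q =
    if p i = k ∧ q i = l ∧ ∀ j, j ≠ i → p j = q j then 1 else 0 := rfl

/-- The configuration `p` with the label of the factor `i` replaced. -/
noncomputable def Config.update (p : Config X) (i : I) (k : X i) : Config X :=
  open Classical in Function.update p i k

theorem Config.update_self (p : Config X) (i : I) (k : X i) : p.update i k i = k :=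
  open Classical in Function.update_self ..

theorem Config.update_of_ne (p : Config X) {i j : I} (h : j ≠ i) (k : X i) :
    p.update i k j = p j :=
  open Classical in Function.update_of_ne h ..

theorem Config.update_eq_self (p : Config X) (i : I) : p.update i (p i) = p :=
  open Classical in Function.update_eq_self ..

theorem Config.update_update (p : Config X) (i : I) (k l : X i) :
    (p.update i k).update i l = p.update i l :=
  open Classical in Function.update_idem ..

variable [Finite I] [∀ i, Finite (X i)]

open Classical in
theorem localUnit_mul (i : I) (k l : X i) (m : Op (Config X)) (p q : Config X) :
    (localUnit i k l * m) p q = if p i = k then m (p.update i l) q else 0 := by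
  rw [Matrix.mul_apply, Finset.sum_eq_single (p.update i l)]
  · rw [localUnit_apply, p.update_self]
    have : ∀ j, j ≠ i → p j = p.update i l j := fun j hj => (p.update_of_ne hj l).symm
    simp +contextual [this]
  · intro r _ hr
    rw [localUnit_apply, if_neg, zero_mul]
    rintro ⟨-, rfl, h⟩
    refine hr (funext fun j => ?_)
    by_cases hj : j = i
    · subst hj
      exact (p.update_self _ _).symm
    · exact (h j hj).symm.trans (p.update_of_ne hj _).symm
  · simp

open Classical in
theorem mul_localUnit (i : I) (k l : X i) (m : Op (Config X)) (p q : Config X) :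
    (m * localUnit i k l) p q = if q i = l then m p (q.update i k) else 0 := by
  rw [Matrix.mul_apply, Finset.sum_eq_single (q.update i k)]
  · rw [localUnit_apply, q.update_self]
    have : ∀ j, j ≠ i → q.update i k j = q j := fun j hj => q.update_of_ne hj k
    simp +contextual [this]
  · intro r _ hr
    rw [localUnit_apply, if_neg, mul_zero]
    rintro ⟨rfl, -, h⟩
    refine hr (funext fun j => ?_)
    by_cases hj : j = i
    · subst hj
      exact (q.update_self _ _).symm
    · exact (h j hj).trans (q.update_of_ne hj _).symm
  · simp

theorem commute_localUnit_iff {i : I} {k l : X i} {m : Op (Config X)} :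
    Commute (localUnit i k l) m ↔ ∀ p q : Config X, (p i = k → q i = l →
      m (p.update i l) q = m p (q.update i k)) ∧ (p i = k → q i ≠ l → m (p.update i l) q = 0) ∧
      (p i ≠ k → q i = l → m p (q.update i k) = 0) := by
  classical
  rw [commute_iff_eq, ← Matrix.ext_iff]
  simp only [localUnit_mul, mul_localUnit]
  refine forall₂_congr fun p q => ?_
  by_cases hp : p i = k <;> by_cases hq : q i = l <;> simp [hp, hq, eq_comm]

theorem commute_localUnit {i j : I} (hij : i ≠ j) (k l : X i) (k' l' : X j) :
    Commute (localUnit i k l) (localUnit j k' l' : Op (Config X)) := by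
  classical
  rw [commute_localUnit_iff]
  intro p q
  simp only [localUnit_apply, Config.update_of_ne _ hij.symm]
  refine ⟨fun hp hq => if_congr (and_congr_right fun _ => and_congr_right fun _ =>
      forall₂_congr fun r hr => ?_) rfl rfl, fun _ hq => if_neg fun h => hq ?_,
    fun hp _ => if_neg fun h => hp ?_⟩
  · by_cases hri : r = i
    · subst hri
      rw [Config.update_self, Config.update_self, hp, hq]
      exact iff_of_true rfl rfl
    · rw [Config.update_of_ne _ hri, Config.update_of_ne _ hri]
  · simpa [Config.update_self] using (h.2.2 i hij).symm
  · simpa [Config.update_self] using h.2.2 i hij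

/-- The operators on the factors in `s` are those that commute with all operators on the other
factors. -/
theorem mem_localOps_iff [∀ i, Nonempty (X i)] {s : Set I} {m : Op (Config X)} :
    m ∈ localOps X s ↔ ∀ i ∉ s, ∀ k l, Commute (localUnit i k l) m := by
  classical
  constructor
  · rintro ⟨N, hN⟩ i hi k l
    have hne : ∀ j : s, (j : I) ≠ i := fun j h => hi (h ▸ j.2)
    rw [commute_localUnit_iff]
    refine fun p q => ⟨fun hp hq => ?_, fun _ hq => ?_, fun hp _ => ?_⟩
    · have hagree : (∀ j, j ∉ s → p.update i l j = q j) ↔ ∀ j, j ∉ s → p j = q.update i k j := by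
        refine forall₂_congr fun j _ => ?_
        by_cases hj : j = i
        · subst hj
          rw [Config.update_self, Config.update_self, hp, hq]
          exact iff_of_true rfl rfl
        · rw [Config.update_of_ne _ hj, Config.update_of_ne _ hj]
      by_cases h : ∀ j, j ∉ s → p j = q.update i k j
      · rw [(hN _ _).1 h, (hN _ _).1 (hagree.2 h)]
        congr 1
        · exact funext fun j => p.update_of_ne (hne j) l
        · exact funext fun j => (q.update_of_ne (hne j) k).symm
      · rw [(hN _ _).2 h, (hN _ _).2 fun h' => h (hagree.1 h')]
    · refine (hN _ _).2 fun h => hq ?_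
      rw [← h i hi, Config.update_self]
    · refine (hN _ _).2 fun h => hp ?_
      rw [h i hi, Config.update_self]
  · intro h
    -- The entry at `p, q` vanishes unless `p` and `q` agree off `s`, and then it does not change if
    -- the labels off `s` are replaced by those of a fixed configuration `d`.
    have h0 : ∀ i ∉ s, ∀ p q : Config X, p i ≠ q i → m p q = 0 := by
      intro i hi p q hpq
      have := ((commute_localUnit_iff.1 (h i hi (q i) (q i))) p q).2.2 hpq rfl
      rwa [Config.update_eq_self] at this
    have h1 : ∀ i ∉ s, ∀ (p q : Config X) (k : X i), p i = q i →
        m p q = m (p.update i k) (q.update i k) := by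
      intro i hi p q k hpq
      have := ((commute_localUnit_iff.1 (h i hi k (q i))) (p.update i k) q).1
        (p.update_self i k) rfl
      rwa [Config.update_update, ← hpq, Config.update_eq_self] at this
    let d : Config X := fun i => Classical.arbitrary (X i)
    let r : Finset I → Config X → Config X := fun F p j => if j ∈ F then d j else p j
    have h2 : ∀ F : Finset I, (∀ i ∈ F, i ∉ s) → ∀ p q : Config X, (∀ i ∈ F, p i = q i) →
        m p q = m (r F p) (r F q) := by
      intro F
      induction F using Finset.induction_on with
      | empty =>
        intro _ p q _
        have hr : ∀ p, r ∅ p = p := fun p => funext fun j => if_neg (Finset.notMem_empty j)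
        rw [hr, hr]
      | insert i F hi ih =>
        intro hF p q hpq
        have hr : ∀ p, r (insert i F) p = (r F p).update i (d i) := by
          intro p
          funext j
          by_cases hj : j = i
          · subst hj
            rw [Config.update_self]
            exact if_pos (Finset.mem_insert_self j F)
          · rw [Config.update_of_ne _ hj]
            exact if_congr (by simp [hj]) rfl rfl
        rw [ih (fun j hj => hF j (Finset.mem_insert_of_mem hj)) p q
          fun j hj => hpq j (Finset.mem_insert_of_mem hj), hr, hr]
        refine h1 i (hF i (Finset.mem_insert_self i F)) _ _ _ ?_
        have hri : ∀ p, r F p i = p i := fun p => if_neg hi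
        rw [hri, hri]
        exact hpq i (Finset.mem_insert_self i F)
    have := Fintype.ofFinite I
    let g : (Config fun i : s => X i) → Config X :=
      fun ξ j => if hj : j ∈ s then ξ ⟨j, hj⟩ else d j
    refine ⟨Matrix.of fun ξ η => m (g ξ) (g η), fun p q => ⟨fun hpq => ?_, fun hpq => ?_⟩⟩
    · have hg : ∀ p : Config X, g (fun i => p i) = r (Finset.univ.filter (· ∉ s)) p := by
        intro p
        funext j
        by_cases hj : j ∈ s
        · exact (dif_pos hj).trans (if_neg (by simpa using hj)).symm
        · exact (dif_neg hj).trans (if_pos (by simpa using hj)).symm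
      refine Eq.trans ?_ (congrArg₂ m (hg p) (hg q)).symm
      exact h2 _ (by simp) p q fun i hi => hpq i (by simpa using hi)
    · push Not at hpq
      obtain ⟨i, hi, hpq⟩ := hpq
      exact h0 i hi p q hpq

theorem localUnit_mem_localOps [∀ i, Nonempty (X i)] (i : I) (k l : X i) :
    localUnit i k l ∈ localOps X {i} := by
  rw [mem_localOps_iff]
  exact fun j hj k' l' => commute_localUnit hj k' l' k l

variable [DecidableEq (Config X)]

variable (X) in
/-- The matrix units of the factor `i` of a composite system. -/
noncomputable def localUnits (i : I) : MatrixUnits (X i) (Op (Config X)) where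
  e := localUnit i
  mul_same k l r := by
    classical
    ext p q
    rw [localUnit_mul, localUnit_apply, localUnit_apply, Config.update_self, ← ite_and]
    refine if_congr ⟨fun h => ⟨h.1, h.2.2.1, fun j hj => ?_⟩,
      fun h => ⟨h.1, rfl, h.2.1, fun j hj => ?_⟩⟩ rfl rfl
    · rw [← h.2.2.2 j hj, Config.update_of_ne _ hj]
    · rw [← h.2.2 j hj, Config.update_of_ne _ hj]
  mul_ne k l l' r h := by
    classical
    ext p q
    rw [localUnit_mul, localUnit_apply, Config.update_self]
    simp [h]
  sum_diag := by
    classical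
    have := Fintype.ofFinite (X i)
    rw [finsum_eq_sum_of_fintype]
    ext p q
    rw [Matrix.sum_apply, Finset.sum_eq_single (p i), localUnit_apply, Matrix.one_apply]
    · refine if_congr ⟨fun h => funext fun j => ?_, fun h => h ▸ ⟨rfl, rfl, fun _ _ => rfl⟩⟩ rfl rfl
      by_cases hj : j = i
      · subst hj
        exact h.2.1.symm
      · exact h.2.2 j hj
    · intro k _ hk
      rw [localUnit_apply, if_neg fun h => hk h.1.symm]
    · simp
  star_e k l := by
    classical
    ext p q
    rw [Matrix.star_apply, localUnit_apply, localUnit_apply, apply_ite star, star_one, star_zero]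
    exact if_congr ⟨fun h => ⟨h.2.1, h.1, fun j hj => (h.2.2 j hj).symm⟩,
      fun h => ⟨h.2.1, h.1, fun j hj => (h.2.2 j hj).symm⟩⟩ rfl rfl

/-- The tensor products of local matrix units are the operators `|x⟩⟨y|`. -/
theorem orderedProd_localUnits (x y : Config X) :
    (orderedProd fun i => localUnits X i (x i) (y i)) = Matrix.single x y 1 := by
  classical
  have key : ∀ l : List I, l.Nodup → ∀ p q : Config X,
      (l.map fun i => localUnits X i (x i) (y i)).prod p q =
        if (∀ i ∈ l, p i = x i ∧ q i = y i) ∧ ∀ i, i ∉ l → p i = q i then 1 else 0 := by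
    intro l
    induction l with
    | nil =>
      intro _ p q
      rw [List.map_nil, List.prod_nil, Matrix.one_apply]
      exact if_congr ⟨fun h => by simp [h], fun h => funext fun i => h.2 i (by simp)⟩ rfl rfl
    | cons i l ih =>
      intro hl p q
      obtain ⟨hi, hl⟩ := List.nodup_cons.1 hl
      rw [List.map_cons, List.prod_cons]
      refine (localUnit_mul i (x i) (y i) _ p q).trans ?_
      rw [ih hl, ← ite_and]
      refine if_congr ⟨?_, ?_⟩ rfl rfl
      · rintro ⟨hp, h, h'⟩
        have hq := h' i hi
        rw [Config.update_self] at hq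
        refine ⟨fun j hj => ?_, fun j hj => ?_⟩
        · rcases List.mem_cons.1 hj with rfl | hj
          · exact ⟨hp, hq.symm⟩
          · have := h j hj
            rwa [Config.update_of_ne _ (ne_of_mem_of_not_mem hj hi)] at this
        · rw [List.mem_cons, not_or] at hj
          rw [← h' j hj.2, Config.update_of_ne _ hj.1]
      · rintro ⟨h, h'⟩
        refine ⟨(h i List.mem_cons_self).1, fun j hj => ?_, fun j hj => ?_⟩
        · rw [Config.update_of_ne _ (ne_of_mem_of_not_mem hj hi)]
          exact h j (List.mem_cons_of_mem i hj)
        · by_cases hji : j = i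
          · subst hji
            rw [Config.update_self, (h j List.mem_cons_self).2]
          · rw [Config.update_of_ne _ hji]
            exact h' j (by simp [hji, hj])
  ext p q
  rw [orderedProd_eq_list, key _ (nodup_indexList I), Matrix.single_apply]
  refine if_congr ⟨fun h => ⟨funext fun i => ((h.1 i (mem_indexList i)).1).symm,
    funext fun i => ((h.1 i (mem_indexList i)).2).symm⟩, ?_⟩ rfl rfl
  rintro ⟨rfl, rfl⟩
  exact ⟨fun i _ => ⟨rfl, rfl⟩, fun i hi => (hi (mem_indexList i)).elim⟩

theorem isFactorization_localUnits : IsFactorization (localUnits X) where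
  commutes i j hij k l k' l' := commute_localUnit hij k l k' l'
  irreducible m hm := by
    obtain ⟨c, hc⟩ := Matrix.mem_range_scalar_of_commute_single (M := m) fun x y _ => by
      change Commute (Matrix.single x y 1) m
      rw [← orderedProd_localUnits]
      exact (commute_orderedProd fun i => (hm i _ _).symm).symm
    exact Algebra.mem_bot.2 ⟨c, hc⟩

end LocalOps

/-! ### The circuit decomposition -/

namespace MatrixUnits

variable {M : Type*} [Ring M] [StarRing M] [Algebra ℂ M]

/-- The image of a system of matrix units under a star-isomorphism. -/
def map {M' : Type*} [Ring M'] [StarRing M'] [Algebra ℂ M'] {ι : Type*} [Finite ι]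
    (E : MatrixUnits ι M) (f : M ≃⋆ₐ[ℂ] M') : MatrixUnits ι M' where
  e i j := f (E i j)
  mul_same i j k := by rw [← map_mul, E.mul_same]
  mul_ne i j k l h := by rw [← map_mul, E.mul_ne _ _ _ _ h, map_zero]
  sum_diag := by
    have := Fintype.ofFinite ι
    rw [finsum_eq_sum_of_fintype, ← map_sum, E.sum_eq_one, map_one]
  star_e i j := by rw [← map_star, E.star_e]

variable [StarModule ℂ M]

/-- Two systems of matrix units that span the same algebra yield a unitary channel between the
systems that they represent. -/
theorem exists_starAlgEquiv [Nontrivial M] {ι κ : Type*} [Fintype ι] [Fintype κ]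
    (E : MatrixUnits ι M) (F : MatrixUnits κ M) (h : E.algebra = F.algebra) :
    ∃ g : Op ι ≃⋆ₐ[ℂ] Op κ, ∀ i i', E i i' = ∑ o, ∑ o', coeff g o o' i i' • F o o' := by
  classical
  have hEF : ∀ N, ∃ N', F.hom N' = E.hom N := fun N =>
    F.mem_algebra_iff.1 (h ▸ E.mem_algebra_iff.2 ⟨N, rfl⟩)
  have hFE : ∀ N, ∃ N', E.hom N' = F.hom N := fun N =>
    E.mem_algebra_iff.1 (h ▸ F.mem_algebra_iff.2 ⟨N, rfl⟩)
  choose g hg using hEF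
  choose g' hg' using hFE
  let e : Op ι ≃⋆ₐ[ℂ] Op κ :=
    { toFun := g
      invFun := g'
      left_inv := fun N => E.hom_injective (by rw [hg', hg])
      right_inv := fun N => F.hom_injective (by rw [hg, hg'])
      map_mul' := fun N N' => F.hom_injective (by rw [map_mul, hg, hg, hg, map_mul])
      map_add' := fun N N' => F.hom_injective (by rw [map_add, hg, hg, hg, map_add])
      map_star' := fun N => F.hom_injective (by rw [map_star, hg, hg, map_star])
      map_smul' := fun c N => F.hom_injective (by rw [map_smul, hg, hg, map_smul]) }
  refine ⟨e, fun i i' => ?_⟩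
  rw [← E.hom_single, ← hg, F.hom_apply]
  refine Finset.sum_congr rfl fun o _ => Finset.sum_congr rfl fun o' _ => ?_
  rw [coeff]
  congr!

/-- In a tensor product of matrix units, `|k⟩⟨l|` on the factor `i` corresponds to `E i k l`. -/
theorem hom_localUnit {I : Type u} [Finite I] {X : I → Type t} [∀ i, Finite (X i)]
    [DecidableEq (Config X)] (E : ∀ i, MatrixUnits (X i) M)
    (hE : Pairwise fun i j => (E i).Commutes (E j)) (i : I) (k l : X i) :
    (tensor E hE).hom (localUnit i k l) = E i k l := by
  classical
  have := Fintype.ofFinite I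
  have := fun i => Fintype.ofFinite (X i)
  have h : localUnit i k l = Matrix.of fun x y : Config X => ∏ᶠ j,
      Function.update (fun j => (1 : Op (X j))) i (Matrix.single k l 1) j (x j) (y j) := by
    ext x y
    rw [localUnit_apply, Matrix.of_apply, finprod_eq_prod_of_fintype,
      ← Finset.mul_prod_erase _ _ (Finset.mem_univ i), Function.update_self]
    have : ∀ j ∈ Finset.univ.erase i, Function.update (fun j => (1 : Op (X j))) i
        (Matrix.single k l 1) j (x j) (y j) = if x j = y j then 1 else 0 := fun j hj => by
      rw [Function.update_of_ne (Finset.ne_of_mem_erase hj), Matrix.one_apply]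
    rw [Finset.prod_congr rfl this, Finset.prod_ite_zero, Matrix.single_apply, Finset.prod_const_one,
      ite_zero_mul_ite_zero, one_mul]
    simp [eq_comm, and_assoc]
  rw [h, tensor_hom_prod, orderedProd_eq_single (i := i), Function.update_self, hom_single]
  intro j hj
  rw [Function.update_of_ne hj, map_one]

end MatrixUnits

section Factorization

variable {M : Type*} [Ring M] [StarRing M] [Algebra ℂ M]
  {I : Type u} {X : I → Type t} [∀ i, Finite (X i)] {E : ∀ i, MatrixUnits (X i) M}

theorem IsFactorization.map {M' : Type*} [Ring M'] [StarRing M'] [Algebra ℂ M']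
    (hE : IsFactorization E) (f : M ≃⋆ₐ[ℂ] M') : IsFactorization fun i => (E i).map f where
  commutes i j hij k l k' l' := (hE.commutes hij k l k' l').map f
  irreducible m hm := by
    have h : f.symm m ∈ (⊥ : Subalgebra ℂ M) := hE.irreducible _ fun i k l => by
      have := (hm i k l).map f.symm
      rwa [show f.symm ((E i).map f k l) = E i k l from f.symm_apply_apply _] at this
    obtain ⟨c, hc⟩ := Algebra.mem_bot.1 h
    refine Algebra.mem_bot.2 ⟨c, ?_⟩
    rw [← f.apply_symm_apply m, ← hc, Algebra.algebraMap_eq_smul_one, Algebra.algebraMap_eq_smul_one,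
      map_smul, map_one]

variable [StarModule ℂ M] [Finite I]

/-- If commuting matrix units span all of `M` together, then they form a factorisation of `M`, in
which the local operators of a factor correspond to the algebra spanned by its matrix units. -/
theorem mem_localOps_singleton_iff [∀ i, Nonempty (X i)] [Nontrivial M] [DecidableEq (Config X)]
    (hE : Pairwise fun i j => (E i).Commutes (E j))
    (hsurj : Function.Surjective (MatrixUnits.tensor E hE).hom) {i : I} {K : Op (Config X)} :
    K ∈ localOps X {i} ↔ (MatrixUnits.tensor E hE).hom K ∈ (E i).algebra := by
  have hfac : IsFactorization E := ⟨hE, fun m hm => by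
    obtain ⟨N, rfl⟩ := hsurj m
    refine (MatrixUnits.tensor E hE).mem_bot_of_commute
      ((MatrixUnits.tensor E hE).mem_algebra_iff.2 ⟨N, rfl⟩) ?_
    exact MatrixUnits.commute_tensor E hE fun i k l => (hm i k l).symm⟩
  rw [mem_localOps_iff, hfac.mem_algebra_iff]
  refine forall₂_congr fun j _ => forall₂_congr fun k l => ?_
  rw [← MatrixUnits.hom_localUnit E hE]
  refine ⟨fun h => h.map _, fun h => (MatrixUnits.tensor E hE).hom_injective ?_⟩
  rw [map_mul, map_mul]
  exact h

end Factorization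

section Main

variable {A : Type u} {B : Type v} [Finite A] [Finite B] {G : A → B → Prop}
  {X : A → Type t} [∀ a, Finite (X a)] {Y : B → Type t} [∀ b, Finite (Y b)]

/-- Two factorisations of a matrix algebra whose factors commute unless they are related by `G`
arise from a circuit of canonical shape, whose wires carry the wire algebras. -/
theorem exists_circuit {κ : Type*} [Fintype κ] [DecidableEq κ] [Nonempty κ]
    (hG : C3Exclusion G) {E : ∀ a, MatrixUnits (X a) (Op κ)} {F : ∀ b, MatrixUnits (Y b) (Op κ)}
    (hE : IsFactorization E) (hF : IsFactorization F)
    (hEF : ∀ a b, ¬ G a b → (E a).Commutes (F b)) :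
    ∃ (C : UnitaryCircuit (canonicalShape G) X Y) (W : C.WireUnits (Op κ)), W.Compatible ∧
      (∀ x, (W.units x).algebra = wireAlgebra E F x) ∧
      (∀ a (k l : X a), W.units (.input a) k l = E a k l) ∧
      ∀ b (k l : Y b), W.units (.output b) k l = F b k l := by
  choose n V hV using exists_matrixUnits_inner hG hE hF hEF
  let Z : ∀ p q : (canonicalShape G).Box, p ⋖ q → Type t := fun p q h => ULift (Fin (n p q h))
  have hZ : ∀ p q h, Finite (Z p q h) := fun p q h => inferInstanceAs (Finite (ULift _))
  let V' : ∀ p q h, MatrixUnits (Z p q h) (Op κ) := fun p q h => (V p q h).reindex Equiv.ulift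
  have hZ' : ∀ p q h, Nonempty (Z p q h) := fun p q h => (V' p q h).nonempty
  let units : ∀ x : (canonicalShape G).Wire, MatrixUnits (wireSystem X Y Z x) (Op κ) := fun x =>
    match x with
    | .input a => E a
    | .inner p q h => V' p q h
    | .output b => F b
  have halg : ∀ x, (units x).algebra = wireAlgebra E F x := fun x =>
    match x with
    | .input a => (wireAlgebra_input hE hEF a).symm
    | .inner p q h => ((V p q h).algebra_reindex Equiv.ulift).trans (hV p q h)
    | .output b => (wireAlgebra_output hF hEF b).symm
  have hcomm : ∀ (T : LowerSet (canonicalShape G).Box) (x y : (canonicalShape G).Wire),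
      x.Live T → y.Live T → x ≠ y → (units x).Commutes (units y) := fun T x y hx hy hxy i j k l =>
    commute_wireAlgebra hG hE hF hx hy hxy (halg x ▸ (units x).e_mem_algebra i j)
      (halg y ▸ (units y).e_mem_algebra k l)
  let into : ∀ p : (canonicalShape G).Box, MatrixUnits
      (Config fun x : {x : (canonicalShape G).Wire // x.target = some p} => wireSystem X Y Z x.1)
      (Op κ) := fun p => MatrixUnits.tensor (fun x => units x.1) fun x y hxy =>
    hcomm (LowerSet.Iio p) x.1 y.1 (live_of_target x.2) (live_of_target y.2)
      fun h => hxy (Subtype.ext h)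
  let outOf : ∀ p : (canonicalShape G).Box, MatrixUnits
      (Config fun x : {x : (canonicalShape G).Wire // x.source = some p} => wireSystem X Y Z x.1)
      (Op κ) := fun p => MatrixUnits.tensor (fun x => units x.1) fun x y hxy =>
    hcomm (LowerSet.Iic p) x.1 y.1 (live_of_source x.2) (live_of_source y.2)
      fun h => hxy (Subtype.ext h)
  have hinto : ∀ p, (into p).algebra = boxAlgebra E F p := by
    refine fun p => le_antisymm (MatrixUnits.tensor_algebra_le _ _ fun x => ?_)
      (boxAlgebra_le_of_target hG hE hF hEF fun x hx => ?_)
    · exact (halg x.1).trans_le (wireAlgebra_le_boxAlgebra_of_target x.2)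
    · exact (halg x).symm.trans_le (MatrixUnits.algebra_le_algebra_tensor
        (fun x : {x : (canonicalShape G).Wire // x.target = some p} => units x.1) _ ⟨x, hx⟩)
  have houtOf : ∀ p, (outOf p).algebra = boxAlgebra E F p := by
    refine fun p => le_antisymm (MatrixUnits.tensor_algebra_le _ _ fun x => ?_)
      (boxAlgebra_le_of_source hG hE hF hEF fun x hx => ?_)
    · exact (halg x.1).trans_le (wireAlgebra_le_boxAlgebra_of_source x.2)
    · exact (halg x).symm.trans_le (MatrixUnits.algebra_le_algebra_tensor
        (fun x : {x : (canonicalShape G).Wire // x.source = some p} => units x.1) _ ⟨x, hx⟩)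
  choose gate hgate using fun p =>
    (into p).exists_starAlgEquiv (outOf p) ((hinto p).trans (houtOf p).symm)
  exact ⟨⟨Z, gate⟩, ⟨units, hcomm⟩, hgate, halg, fun _ _ _ => rfl, fun _ _ _ => rfl⟩

theorem UnitaryCircuit.finalLabels_bijective {S : CircuitShape.{u, v, w} A B}
    (C : UnitaryCircuit S X Y) : Function.Bijective C.finalLabels := by
  refine ⟨fun y y' h => funext fun b => ?_, fun o => ?_⟩
  · exact congrFun h ⟨.output b, fun _ _ => LowerSet.mem_top, fun _ h => by cases h⟩
  · refine ⟨fun b => o ⟨.output b, fun _ _ => LowerSet.mem_top, fun _ h => by cases h⟩, ?_⟩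
    funext x
    obtain ⟨x, hx⟩ := x
    cases x with
    | input a => exact (hx.2 _ rfl LowerSet.mem_top).elim
    | inner p q h => exact (hx.2 _ rfl LowerSet.mem_top).elim
    | output b => rfl

/-- The composite of all gates is the identity of `M`, read in the matrix units of the input wires
and of the output wires. -/
theorem UnitaryCircuit.WireUnits.sum_total_smul {M : Type*} [Ring M] [StarRing M] [Algebra ℂ M]
    {S : CircuitShape.{u, v, w} A B} {C : UnitaryCircuit S X Y} {W : C.WireUnits M}
    (hW : W.Compatible) (N : Op (Config X)) :
    ∑ y : Config Y, ∑ y' : Config Y, C.total N y y' •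
        (orderedProd fun b => W.units (.output b) (y b) (y' b)) =
      ∑ i, ∑ i', N i i' • orderedProd fun a => W.units (.input a) (i a) (i' a) := by
  rw [← WireUnits.sum_compose_smul_live hW ⊤ N]
  let σ := Equiv.ofBijective C.finalLabels C.finalLabels_bijective
  refine Fintype.sum_equiv σ _ _ fun y => Fintype.sum_equiv σ _ _ fun y' => ?_
  refine congrArg (C.total N y y' • ·) ?_
  let g : B → {x : S.Wire // x.Live ⊤} := fun b =>
    ⟨.output b, fun _ _ => LowerSet.mem_top, fun _ h => by cases h⟩
  refine orderedProd_comp (g := g) (f := fun x : {x : S.Wire // x.Live ⊤} =>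
    W.units x.1 (C.finalLabels y x) (C.finalLabels y' x))
    (fun x y hxy => W.commutes ⊤ x.1 y.1 x.2 y.2 (fun h => hxy (Subtype.ext h)) _ _ _ _) ?_
  refine ⟨fun b b' h => Wire.output.inj (Subtype.mk.inj h), fun x => ?_⟩
  obtain ⟨x, hx⟩ := x
  cases x with
  | input a => exact (hx.2 _ rfl LowerSet.mem_top).elim
  | inner p q h => exact (hx.2 _ rfl LowerSet.mem_top).elim
  | output b => exact ⟨b, rfl⟩

/-- The tensor product of identity channels is the identity. -/
theorem tensorMap_refl [∀ b, Fintype (Y b)] (N : Op (Config Y)) :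
    tensorMap (fun b => (StarAlgEquiv.refl ℂ (Op (Y b)))) N = N := by
  classical
  have := Fintype.ofFinite B
  have hc : ∀ (b : B) (o o' i i' : Y b),
      coeff (StarAlgEquiv.refl ℂ (Op (Y b))) o o' i i' =
        if i = o ∧ i' = o' then 1 else 0 := fun b o o' i i' => by
    change Matrix.single i i' 1 o o' = _
    rw [Matrix.single_apply]
  ext o o'
  have hne : ∀ i i' : Config Y, ∀ b, ¬ (i b = o b ∧ i' b = o' b) →
      ∏ᶠ k, coeff (StarAlgEquiv.refl ℂ (Op (Y k))) (o k) (o' k) (i k) (i' k) = 0 := by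
    intro i i' b hb
    rw [finprod_eq_prod_of_fintype]
    exact Finset.prod_eq_zero (Finset.mem_univ b) ((hc _ _ _ _ _).trans (if_neg hb))
  refine (Finset.sum_eq_single o (fun i _ hi => ?_) (by simp)).trans
    ((Finset.sum_eq_single o' (fun i' _ hi' => ?_) (by simp)).trans ?_)
  · obtain ⟨b, hb⟩ := Function.ne_iff.1 hi
    exact Finset.sum_eq_zero fun i' _ => mul_eq_zero_of_left (hne i i' b fun h => hb h.1) _
  · obtain ⟨b, hb⟩ := Function.ne_iff.1 hi'
    exact mul_eq_zero_of_left (hne o i' b fun h => hb h.2) _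
  · have : ∀ k, coeff (StarAlgEquiv.refl ℂ (Op (Y k))) (o k) (o' k) (o k) (o' k) = 1 :=
      fun k => (hc _ _ _ _ _).trans (if_pos ⟨rfl, rfl⟩)
    exact (congrArg (· * N o o') ((finprod_congr this).trans finprod_one)).trans (one_mul _)

end Main

end CausalCircuits

theorem theorem3 {A : Type u} {B : Type v} [Finite A] [Finite B] (G : A → B → Prop)
    (hG : C3Exclusion G)
    (X : A → Type t) [∀ a, Fintype (X a)] [∀ a, Nonempty (X a)]
    (Y : B → Type t) [∀ b, Fintype (Y b)] [∀ b, Nonempty (Y b)]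
    (U : Op (Config X) ≃⋆ₐ[ℂ] Op (Config Y))
    (hU : ∀ a b, causalStructure U a b → G a b) :
    (∃ C : UnitaryCircuit (canonicalShape G) X Y,
      (∀ v : (canonicalShape G).Box,
        (∀ (b : B) (h : (canonicalShape G).out b = v),
          localOps (C.liveSys (LowerSet.Iic v)) {⟨Wire.output b, Wire.live_output h⟩} =
            C.compose (LowerSet.Iic v) '' (U.symm '' localOps Y {b})) ∧
        (∀ (w : (canonicalShape G).Box) (h : v ⋖ w),
          localOps (C.liveSys (LowerSet.Iic v)) {⟨Wire.inner v w h, Wire.live_inner h⟩} ⊆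
            C.compose (LowerSet.Iic v) '' (U.symm '' localOps Y (Concept.intent w)))) ∧
      ∃ W : ∀ b, Op (Y b) ≃⋆ₐ[ℂ] Op (Y b),
        ∀ M, U M = tensorMap (fun b => W b) (C.total M)) ∧
    ∃ C : UnitaryCircuit (canonicalShape G) X Y, ∀ M, C.total M = U M := by
  classical
  let E : ∀ a, MatrixUnits (X a) (Op (Config X)) := localUnits X
  let F : ∀ b, MatrixUnits (Y b) (Op (Config X)) := fun b => (localUnits Y b).map U.symm
  have hE : IsFactorization E := isFactorization_localUnits
  have hF : IsFactorization F := isFactorization_localUnits.map U.symm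
  have hEF : ∀ a b, ¬ G a b → (E a).Commutes (F b) := by
    intro a b hab i j k l
    have h : U.symm '' localOps Y {b} ⊆ Set.centralizer (localOps X {a}) :=
      not_not.1 fun h => hab (hU a b h)
    exact h ⟨_, localUnit_mem_localOps b k l, rfl⟩ _ (localUnit_mem_localOps a i j)
  obtain ⟨C, W, hW, halg, hin, hout⟩ := exists_circuit hG hE hF hEF
  -- The composite of the gates in `T` inverts `(W.live T).hom`.
  have hcompose : ∀ T N, (W.live T).hom (C.compose T N) = N := by
    intro T N
    rw [MatrixUnits.hom_apply, W.sum_compose_smul_live hW]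
    conv_rhs => rw [Matrix.matrix_eq_sum_single N]
    refine Finset.sum_congr rfl fun i _ => Finset.sum_congr rfl fun i' _ => ?_
    have h : (orderedProd fun a => W.units (.input a) (i a) (i' a)) = Matrix.single i i' 1 :=
      (congrArg orderedProd (funext fun a => hin a (i a) (i' a))).trans
        (orderedProd_localUnits i i')
    rw [h, Matrix.smul_single, smul_eq_mul, mul_one]
  have himage : ∀ T (s : Set (Op (Config X))) K, K ∈ C.compose T '' s ↔ (W.live T).hom K ∈ s := by
    refine fun T s K => ⟨?_, fun h => ⟨_, h, (W.live T).hom_injective (hcompose T _)⟩⟩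
    rintro ⟨N, hN, rfl⟩
    rwa [hcompose]
  have hlive : ∀ T (x : {x : (canonicalShape G).Wire // x.Live T}) K,
      K ∈ localOps (C.liveSys T) {x} ↔ (W.live T).hom K ∈ wireAlgebra E F x.1 := by
    intro T x K
    have : ∀ x, Nonempty (C.liveSys T x) := fun x => (W.units x.1).nonempty
    rw [← halg]
    exact mem_localOps_singleton_iff _ fun N => ⟨_, hcompose T N⟩
  have hlocal : ∀ (s : Set B) N, N ∈ U.symm '' localOps Y s ↔
      ∀ b ∉ s, ∀ k l, Commute (F b k l) N := by
    refine fun s N => ⟨?_, fun h => ⟨U N, mem_localOps_iff.2 fun b hb k l => ?_, U.symm_apply_apply N⟩⟩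
    · rintro ⟨N, hN, rfl⟩ b hb k l
      exact (mem_localOps_iff.1 hN b hb k l).map U.symm
    · have := (h b hb k l).map U
      rwa [show U (F b k l) = localUnit b k l from U.apply_symm_apply _] at this
  have htotal : ∀ M, C.total M = U M := by
    intro N
    have h := UnitaryCircuit.WireUnits.sum_total_smul hW N
    have hF' : ∀ y y' : Config Y, (orderedProd fun b => W.units (.output b) (y b) (y' b)) =
        U.symm (Matrix.single y y' 1) := fun y y' => by
      rw [← orderedProd_localUnits, map_orderedProd]
      exact congrArg orderedProd (funext fun b => hout b (y b) (y' b))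
    rw [← W.sum_compose_smul_live hW ⊤, ← MatrixUnits.hom_apply, hcompose] at h
    simp only [hF', ← map_smul, ← map_sum, Matrix.smul_single, smul_eq_mul, mul_one] at h
    rw [← Matrix.matrix_eq_sum_single] at h
    conv_rhs => rw [← h, U.apply_symm_apply]
  refine ⟨⟨C, fun v => ⟨fun b h => ?_, fun w h K hK => ?_⟩, fun b => StarAlgEquiv.refl ℂ (Op (Y b)),
    fun N => ?_⟩, C, htotal⟩
  · ext K
    rw [himage, hlive, hlocal, wireAlgebra_output hF hEF, hF.mem_algebra_iff]
    exact Iff.rfl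
  · rw [hlive] at hK
    rw [himage, hlocal]
    exact fun b hb k l => (mem_localAlgebra.1 hK).2 b hb _ ⟨k, l, rfl⟩
  · rw [htotal, tensorMap_refl]
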